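/- Let $V,W$ be real vector spaces of finite dimensions $m$ and $n$. Conventions. A cone in a finite-dimensional real vector space $E$ is a subset closed under nonnegative linear combinations. A face of a cone $C$ is a cone $F\subseteq C$ such that $c_1,c_2\in C$ and $c_1+c_2\in F$ imply $c_1,c_2\in F$; it is exposed if $F=C\cap\ker\phi$ for some linear functional $\phi$ on $E$ with $\phi\geq 0$ on $C$. A cone $C$ in $E$ is almost compact if it is closed, spans $E$, and is pointed, i.e. $\{0\}$ is an exposed face of $C$. For a real vector space $U$, $S_+(U)\subseteq \operatorname{Sym}^2(U)$ is the cone of sums of squares. For cones $C\subseteq E$, $D\subseteq E'$ let $C\otimes D\subseteq E\otimes E'$ be the convex cone generated by all $c\otimes d$ with $c\in C$, $d\in D$; let $\operatorname{Hom}(C,D)$ be the cone of linear maps $f:E\to E'$ with $f(C)\subseteq D$; and let $\operatorname{Sym}^2(C)\subseteq\operatorname{Sym}^2(E)$ be the convex cone generated by all $c_1c_2$ with $c_1,c_2\in C$. An almost compact cone $C$ in $E$ is a spectrahedral cone if $C=\psi^{-1}(S_+(U^*))$ for some finite-dimensional $U$ and some injective linear map $\psi:E\to\operatorname{Sym}^2(U^*)$;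 an almost compact cone is an SDR cone if it is the image of a spectrahedral cone under a linear map. A spectrahedron in $E$ is a set $\{x\in E: A+B(x)\succeq 0\}$ and an SDR set in $E$ is a set $\{x\in E:\exists y\in\mathbb{R}^l,\ A+B(x)+C(y)\succeq 0\}$, where $A$ is a real symmetric matrix and $B,C$ are linear maps into symmetric matrices of the same size. Theorem. 1. If $\min(m,n)\leq 2$, then $S_+(V)\otimes S_+(W)$ is a spectrahedral cone (in particular a spectrahedron), and $\operatorname{Hom}(S_+(V),S_+(W))$ is an SDR cone and an SDR set. 2. If $m\leq 2$, then $\operatorname{Sym}^2(S_+(V))$ is an SDR cone and an SDR set. 3. If $m=n=3$, then $S_+(V)\otimes S_+(W)$ has a non-exposed face; moreover it is not a spectrahedron, and in particular not a spectrahedral cone. -/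

import Mathlib

open Module
open scoped TensorProduct

noncomputable section

namespace ConeFunctors

variable {E F : Type*} [AddCommGroup E] [Module ℝ E] [AddCommGroup F] [Module ℝ F]

/-- `F` is the exposed face of the cone `C` cut out by some witness: a linear functional that is
nonnegative on `C` and vanishes on exactly the points of `F` among the points of `C`. -/
def IsExposedFace (F C : PointedCone ℝ E) : Prop :=
  ∃ φ : Dual ℝ E, (∀ c ∈ C, 0 ≤ φ c) ∧ (F : Set E) = {c | c ∈ C ∧ φ c = 0}

/-- Almost compact cones: pointed (the origin is an exposed face), closed, full-dimensional
convex cones in a finite-dimensional real vector space. The module topology of a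
finite-dimensional real vector space is its Euclidean topology. -/
structure IsAlmostCompact (C : PointedCone ℝ E) : Prop where
  finite : FiniteDimensional ℝ E
  pointed : IsExposedFace ⊥ C
  closed : @IsClosed E (moduleTopology ℝ E) (C : Set E)
  full : Submodule.span ℝ (C : Set E) = ⊤

/-- The `p`-th symmetric power of a cone: the convex cone generated by the products
`v₁ ⋯ v_p` with all `v_i` in the cone. -/
def symPower (p : ℕ) (C : PointedCone ℝ E) : PointedCone ℝ (Sym[ℝ]^p E) :=
  PointedCone.hull ℝ {x | ∃ v : Fin p → E, (∀ i, v i ∈ C) ∧ x = SymmetricPower.tprod ℝ v}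

/-- The cone of linear maps that send the cone `C` into the cone `D`. -/
def homCone (C : PointedCone ℝ E) (D : PointedCone ℝ F) : PointedCone ℝ (E →ₗ[ℝ] F) where
  carrier := {f | ∀ c ∈ C, f c ∈ D}
  add_mem' hf hg c hc := D.add_mem (hf c hc) (hg c hc)
  zero_mem' _ _ := D.zero_mem
  smul_mem' a _ hf c hc := Submodule.smul_mem D a (hf c hc)

/-- The cone `S₊(V)` of sums of squares `v²` in `Sym² V`. A nonnegative multiple of a square is a
square, so the cone generated by the squares is the set of sums of squares. -/
def psdCone (V : Type*) [AddCommGroup V] [Module ℝ V] : PointedCone ℝ (Sym[ℝ]^2 V) :=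
  PointedCone.hull ℝ (Set.range fun v : V => SymmetricPower.tprod ℝ fun _ : Fin 2 => v)

/-- Spectrahedral cones: almost compact cones that are the preimage of a cone `S₊(U*)` under an
injective linear map, `U` a finite-dimensional real vector space. -/
def IsSpectrahedralCone (C : PointedCone ℝ E) : Prop :=
  IsAlmostCompact C ∧ ∃ (k : ℕ) (ψ : E →ₗ[ℝ] Sym[ℝ]^2 (Dual ℝ (Fin k → ℝ))),
    Function.Injective ψ ∧ C = (psdCone (Dual ℝ (Fin k → ℝ))).comap ψ

/-- SDR cones: almost compact cones that are the image of a spectrahedral cone under a linear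
map. -/
def IsSDRCone (D : PointedCone ℝ E) : Prop :=
  IsAlmostCompact D ∧ ∃ (k : ℕ) (C : PointedCone ℝ (Fin k → ℝ)) (π : (Fin k → ℝ) →ₗ[ℝ] E),
    IsSpectrahedralCone C ∧ C.map π = D

/-- Spectrahedra: solution sets of a linear matrix inequality `A + B x ⪰ 0`, with `A` symmetric
and `B` linear with symmetric values. -/
def IsSpectrahedron (S : Set E) : Prop :=
  ∃ (k : ℕ) (A : Matrix (Fin k) (Fin k) ℝ) (B : E →ₗ[ℝ] Matrix (Fin k) (Fin k) ℝ),
    A.IsSymm ∧ (∀ x, (B x).IsSymm) ∧ S = {x | (A + B x).PosSemidef}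

/-- SDR sets: sets of the form `{x | ∃ y ∈ ℝˡ, A + B x + C y ⪰ 0}`, with `A` symmetric and `B`,
`C` linear with symmetric values. -/
def IsSDRSet (S : Set E) : Prop :=
  ∃ (k l : ℕ) (A : Matrix (Fin k) (Fin k) ℝ) (B : E →ₗ[ℝ] Matrix (Fin k) (Fin k) ℝ)
    (C : (Fin l → ℝ) →ₗ[ℝ] Matrix (Fin k) (Fin k) ℝ),
    A.IsSymm ∧ (∀ x, (B x).IsSymm) ∧ (∀ y, (C y).IsSymm) ∧
      S = {x | ∃ y, (A + B x + C y).PosSemidef}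

end ConeFunctors

end

open ConeFunctors

/-! In coordinates, `Sym² V ⊗ Sym² W` is a space of symmetric matrices on `ι × κ` fixed by partial
transposition, and the tensor cone consists of the separable ones, the sums of squares of elementary
tensors. Separable matrices are positive semidefinite.

If a factor has dimension at most two, the converse holds (`mem_sepCone_of_min_le_two`). A `2 × 2`
block matrix with symmetric blocks `A, B, B, C` has `A` and `B` simultaneously diagonalized by a
congruence, and the Schur complement is a positive remainder. Hence the tensor cone is cut out by
one linear matrix inequality. Dually, a functional nonnegative on the maps with positive
semidefinite Choi matrix is itself separable, so it is nonnegative on every positive map. By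
separation, the Hom cone is the linear image of a positive semidefinite cone
(`map_choiSym_eq_homCone`). The symmetric square of the cone is a linear image of its tensor square.
The trace factors through these linear maps, which makes the images closed and pointed.

For `3 × 3`, take a nonnegative biquadratic form `ckl` with ten zeros, each giving a point `v² ⊗
w²`. Let `z` be the sum of nine of these points and `q` the tenth. A functional that is nonnegative
on the cone and zero at `z` vanishes on the tangent spaces at the nine points. Their sum contains
`q`, so the functional vanishes at `q` (`dual_lastZero_eq_zero`). Yet no `z - t q` with `t > 0` lies
in the cone: `ckl` vanishes there, while `cklSep`, nonnegative on the zeros of `ckl`, is negative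
(`zeroSum_sub_smul_notMem`). So the minimal face of `z` is not exposed. In a spectrahedron the
kernel vectors at `z` yield such functionals, which would put some `z - t q` in the cone
(`not_isSpectrahedron_of_sub_notMem`). -/

noncomputable section

namespace ConeFunctors

/-! ### The symmetric square and symmetric matrices. -/

section SymmetricSquare

variable {V F : Type*} [AddCommGroup V] [Module ℝ V] [AddCommGroup F] [Module ℝ F]

/-- The product `x y` in the symmetric square, as a bilinear map. -/
def symMul : V →ₗ[ℝ] V →ₗ[ℝ] Sym[ℝ]^2 V :=
  have h0 (x y z : V) : Function.update ![x, y] 0 z = ![z, y] := by ext i; fin_cases i <;> rfl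
  have h1 (x y z : V) : Function.update ![x, y] 1 z = ![x, z] := by ext i; fin_cases i <;> rfl
  LinearMap.mk₂ ℝ (fun x y => SymmetricPower.tprod ℝ ![x, y])
    (fun x x' y => by
      simpa only [h0] using
        (SymmetricPower.tprod ℝ (ι := Fin 2) (M := V)).map_update_add ![x, y] 0 x x')
    (fun c x y => by
      simpa only [h0] using
        (SymmetricPower.tprod ℝ (ι := Fin 2) (M := V)).map_update_smul ![x, y] 0 c x)
    (fun x y y' => by
      simpa only [h1] using
        (SymmetricPower.tprod ℝ (ι := Fin 2) (M := V)).map_update_add ![x, y] 1 y y')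
    (fun c x y => by
      simpa only [h1] using
        (SymmetricPower.tprod ℝ (ι := Fin 2) (M := V)).map_update_smul ![x, y] 1 c y)

theorem tprod_eq_symMul (v : Fin 2 → V) :
    SymmetricPower.tprod ℝ v = symMul (v 0) (v 1) := by
  simp only [symMul, LinearMap.mk₂_apply]
  congr 1
  ext i
  fin_cases i <;> rfl

theorem symMul_comm (x y : V) : symMul x y = symMul y x := by
  have := SymmetricPower.tprod_equiv (R := ℝ) (Equiv.swap (0 : Fin 2) 1) ![x, y]
  rw [tprod_eq_symMul, tprod_eq_symMul] at this
  simpa using this.symm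

theorem span_symMul : Submodule.span ℝ {s : Sym[ℝ]^2 V | ∃ x y, s = symMul x y} = ⊤ := by
  rw [eq_top_iff, ← SymmetricPower.span_tprod_eq_top ℝ (Fin 2) V]
  refine Submodule.span_mono ?_
  rintro _ ⟨v, rfl⟩
  exact ⟨v 0, v 1, tprod_eq_symMul v⟩

theorem symMul_induction {p : Sym[ℝ]^2 V → Prop} (hmul : ∀ x y, p (symMul x y)) (hzero : p 0)
    (hadd : ∀ s t, p s → p t → p (s + t)) (hsmul : ∀ (c : ℝ) s, p s → p (c • s))
    (s : Sym[ℝ]^2 V) : p s := by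
  have hs : s ∈ Submodule.span ℝ {s : Sym[ℝ]^2 V | ∃ x y, s = symMul x y} := by
    rw [span_symMul]; trivial
  induction hs using Submodule.span_induction with
  | mem x h => obtain ⟨x, y, rfl⟩ := h; exact hmul x y
  | zero => exact hzero
  | add x y _ _ hx hy => exact hadd x y hx hy
  | smul a x _ hx => exact hsmul a x hx

theorem symMul_polarization (x y : V) :
    symMul x y = (1 / 4 : ℝ) • (symMul (x + y) (x + y) - symMul (x - y) (x - y)) := by
  simp only [map_add, map_sub, LinearMap.add_apply, LinearMap.sub_apply, symMul_comm y x]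
  module

theorem span_symMul_self : Submodule.span ℝ {s : Sym[ℝ]^2 V | ∃ x, s = symMul x x} = ⊤ := by
  rw [eq_top_iff, ← span_symMul, Submodule.span_le]
  rintro _ ⟨x, y, rfl⟩
  rw [symMul_polarization]
  exact Submodule.smul_mem _ _ (Submodule.sub_mem _ (Submodule.subset_span ⟨_, rfl⟩)
    (Submodule.subset_span ⟨_, rfl⟩))

/-- The linear map out of the symmetric square induced by a symmetric bilinear map. -/
def symLift (B : V →ₗ[ℝ] V →ₗ[ℝ] F) (hB : ∀ x y, B x y = B y x) : Sym[ℝ]^2 V →ₗ[ℝ] F :=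
  let m : MultilinearMap ℝ (fun _ : Fin 2 => V) F :=
    { toFun := fun v => B (v 0) (v 1)
      map_update_add' := by
        intro _ v i x y
        fin_cases i <;> simp [Function.update]
      map_update_smul' := by
        intro _ v i c x
        fin_cases i <;> simp [Function.update] }
  let L := PiTensorProduct.lift m
  let φ : Sym[ℝ]^2 V →+ F := AddCon.lift _ L.toAddMonoidHom (by
    refine AddCon.addConGen_le.2 ?_
    rintro _ _ ⟨e, f⟩
    rw [AddCon.ker_rel]
    simp only [LinearMap.toAddMonoidHom_coe]
    simp only [L, PiTensorProduct.lift.tprod]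
    change B (f 0) (f 1) = B (f (e 0)) (f (e 1))
    rcases (by decide +revert : (e 0 = 0 ∧ e 1 = 1) ∨ (e 0 = 1 ∧ e 1 = 0)) with h | h
    · rw [h.1, h.2]
    · rw [h.1, h.2, hB])
  { φ with
    map_smul' := fun c s => by
      induction s using AddCon.induction_on with
      | H s => exact L.map_smul c s }

@[simp]
theorem symLift_symMul (B : V →ₗ[ℝ] V →ₗ[ℝ] F) (hB : ∀ x y, B x y = B y x) (x y : V) :
    symLift B hB (symMul x y) = B x y := by
  change PiTensorProduct.lift _ (PiTensorProduct.tprod ℝ ![x, y]) = _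
  simp

variable {ι : Type*}

/-- The symmetric matrix of an element of the symmetric square with respect to a basis. -/
def symMat (b : Basis ι ℝ V) : Sym[ℝ]^2 V →ₗ[ℝ] Matrix ι ι ℝ :=
  symLift
    -- The factor `1 / 2` normalizes the matrix of `x²` to the rank-one matrix `x xᵀ`.
    (LinearMap.mk₂ ℝ (fun x y => Matrix.of fun i j =>
        (1 / 2 : ℝ) * (b.repr x i * b.repr y j + b.repr y i * b.repr x j))
      (fun x x' y => by ext; simp; ring) (fun c x y => by ext; simp; ring)
      (fun x y y' => by ext; simp; ring) (fun c x y => by ext; simp; ring))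
    (fun x y => by ext; simp; ring)

theorem symMat_symMul (b : Basis ι ℝ V) (x y : V) (i j : ι) :
    symMat b (symMul x y) i j =
      (1 / 2 : ℝ) * (b.repr x i * b.repr y j + b.repr y i * b.repr x j) := by
  simp [symMat]

theorem symMat_symMul_self (b : Basis ι ℝ V) (x : V) :
    symMat b (symMul x x) = Matrix.vecMulVec (b.repr x) (b.repr x) := by
  ext i j
  rw [symMat_symMul, Matrix.vecMulVec_apply]
  ring

theorem symMat_transpose (b : Basis ι ℝ V) (s : Sym[ℝ]^2 V) :
    (symMat b s).transpose = symMat b s := by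
  induction s using symMul_induction with
  | hmul x y => ext i j; simp only [Matrix.transpose_apply, symMat_symMul]; ring
  | hzero => simp
  | hadd s t hs ht => simp [hs, ht]
  | hsmul c s hs => simp [hs]

variable [Fintype ι]

/-- The element `∑ A i j • b i * b j` of the symmetric square. -/
def matSym (b : Basis ι ℝ V) : Matrix ι ι ℝ →ₗ[ℝ] Sym[ℝ]^2 V where
  toFun A := ∑ i, ∑ j, A i j • symMul (b i) (b j)
  map_add' A B := by simp [add_smul, Finset.sum_add_distrib]
  map_smul' c A := by simp [mul_smul, Finset.smul_sum]

theorem matSym_apply (b : Basis ι ℝ V) (A : Matrix ι ι ℝ) :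
    matSym b A = ∑ i, ∑ j, A i j • symMul (b i) (b j) := rfl

theorem symMul_eq_sum (b : Basis ι ℝ V) (x y : V) :
    symMul x y = ∑ i, ∑ j, (b.repr x i * b.repr y j) • symMul (b i) (b j) := by
  conv_lhs => rw [← b.sum_repr x, ← b.sum_repr y]
  simp only [map_sum, map_smul, LinearMap.sum_apply, LinearMap.smul_apply, Finset.smul_sum,
    smul_smul]
  rw [Finset.sum_comm]
  simp only [mul_comm]

theorem matSym_symMat (b : Basis ι ℝ V) (s : Sym[ℝ]^2 V) : matSym b (symMat b s) = s := by
  induction s using symMul_induction with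
  | hmul x y =>
    have h : symMat b (symMul x y) = (1 / 2 : ℝ) • (Matrix.of (fun i j => b.repr x i * b.repr y j)
        + Matrix.of (fun i j => b.repr y i * b.repr x j)) := by
      ext i j; simp [symMat_symMul]
    have h1 : ∀ x y : V, matSym b (Matrix.of fun i j => b.repr x i * b.repr y j) = symMul x y :=
      fun x y => (symMul_eq_sum b x y).symm
    rw [h, map_smul, map_add, h1, h1, symMul_comm y x]
    module
  | hzero => simp
  | hadd s t hs ht => simp [hs, ht]
  | hsmul c s hs => simp [hs]

theorem symMat_injective (b : Basis ι ℝ V) : Function.Injective (symMat b) :=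
  Function.LeftInverse.injective (matSym_symMat b)

/-- Symmetry of `A` is essential: `matSym` kills antisymmetric matrices because the product
commutes. -/
theorem symMat_matSym [DecidableEq ι] (b : Basis ι ℝ V) {A : Matrix ι ι ℝ} (hA : A.IsSymm) :
    symMat b (matSym b A) = A := by
  ext k l
  have h : ∀ i j, A i j * ((1 / 2 : ℝ) * ((if i = k then 1 else 0) * (if j = l then 1 else 0) +
      (if j = k then 1 else 0) * (if i = l then 1 else 0))) =
      (if i = k then if j = l then A i j / 2 else 0 else 0) +
      (if i = l then if j = k then A i j / 2 else 0 else 0) := by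
    intro i j
    split_ifs <;> ring
  simp only [matSym_apply, map_sum, map_smul, Matrix.sum_apply, Matrix.smul_apply, symMat_symMul,
    Basis.repr_self, Finsupp.single_apply, smul_eq_mul, h, Finset.sum_add_distrib]
  simp [hA.apply k l]

instance [FiniteDimensional ℝ V] : FiniteDimensional ℝ (Sym[ℝ]^2 V) :=
  FiniteDimensional.of_injective (symMat (finBasis ℝ V)) (symMat_injective _)

theorem exists_orthogonal_diagonalization {ι : Type*} [Fintype ι] [DecidableEq ι]
    {A : Matrix ι ι ℝ} (hA : A.IsSymm) :
    ∃ (U : Matrix ι ι ℝ) (d : ι → ℝ), U.transpose * U = 1 ∧ U * U.transpose = 1 ∧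
      A = U * Matrix.diagonal d * U.transpose := by
  have hA' : A.IsHermitian := by
    rw [Matrix.IsHermitian, Matrix.conjTranspose_eq_transpose_of_trivial]; exact hA
  have h1 := Unitary.star_mul_self_of_mem hA'.eigenvectorUnitary.2
  have h2 := Unitary.mul_star_self_of_mem hA'.eigenvectorUnitary.2
  rw [Matrix.star_eq_conjTranspose, Matrix.conjTranspose_eq_transpose_of_trivial] at h1 h2
  refine ⟨hA'.eigenvectorUnitary, hA'.eigenvalues, h1, h2, ?_⟩
  conv_lhs => rw [hA'.spectral_theorem]
  rw [Unitary.conjStarAlgAut_apply, Matrix.star_eq_conjTranspose,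
    Matrix.conjTranspose_eq_transpose_of_trivial]
  rfl

theorem diag_nonneg_of_posSemidef_conj {ι : Type*} [Fintype ι] [DecidableEq ι]
    {U : Matrix ι ι ℝ} {d : ι → ℝ} (hU : U.transpose * U = 1)
    (h : (U * Matrix.diagonal d * U.transpose).PosSemidef) (i : ι) : 0 ≤ d i := by
  have h1 := h.conjTranspose_mul_mul_same U
  rw [Matrix.conjTranspose_eq_transpose_of_trivial] at h1
  have h2 : U.transpose * (U * Matrix.diagonal d * U.transpose) * U = Matrix.diagonal d := by
    calc _ = (U.transpose * U) * Matrix.diagonal d * (U.transpose * U) := by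
          simp only [Matrix.mul_assoc]
      _ = _ := by rw [hU, one_mul, mul_one]
  rw [h2] at h1
  simpa using h1.diag_nonneg (i := i)

theorem isSymm_of_posSemidef {ι : Type*} {A : Matrix ι ι ℝ} (hA : A.PosSemidef) : A.IsSymm := by
  have := hA.1
  rwa [Matrix.IsHermitian, Matrix.conjTranspose_eq_transpose_of_trivial] at this

/-- The summands are the eigenvectors scaled by the square roots of their eigenvalues. -/
theorem exists_eq_sum_vecMulVec {ι : Type*} [Fintype ι] {A : Matrix ι ι ℝ}
    (hA : A.PosSemidef) : ∃ w : ι → ι → ℝ, A = ∑ k, Matrix.vecMulVec (w k) (w k) := by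
  classical
  obtain ⟨U, d, hU, -, rfl⟩ := exists_orthogonal_diagonalization (isSymm_of_posSemidef hA)
  have hd := diag_nonneg_of_posSemidef_conj hU hA
  refine ⟨fun k i => √(d k) * U i k, ?_⟩
  ext i j
  rw [Matrix.mul_apply]
  simp only [Matrix.sum_apply, Matrix.vecMulVec_apply, Matrix.transpose_apply,
    Matrix.mul_diagonal]
  refine Finset.sum_congr rfl fun k _ => ?_
  have := Real.mul_self_sqrt (hd k)
  linear_combination (-U i k * U j k) * this

theorem posSemidef_vecMulVec {ι : Type*} [Finite ι] (v : ι → ℝ) :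
    (Matrix.vecMulVec v v).PosSemidef := by
  simpa using Matrix.posSemidef_vecMulVec_self_star v

theorem symMul_self_mem_psdCone (v : V) : symMul v v ∈ psdCone V :=
  Submodule.subset_span ⟨v, tprod_eq_symMul _⟩

/-- The bridge from sums of squares to matrices: a rank-one decomposition lifts to squares of
vectors of `V`. -/
theorem mem_psdCone_iff (b : Basis ι ℝ V) (s : Sym[ℝ]^2 V) :
    s ∈ psdCone V ↔ (symMat b s).PosSemidef := by
  constructor
  · intro h
    induction h using Submodule.span_induction with
    | mem x h =>
      obtain ⟨v, rfl⟩ := h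
      simp only [tprod_eq_symMul, symMat_symMul_self]
      exact posSemidef_vecMulVec _
    | zero => simpa using Matrix.PosSemidef.zero
    | add x y _ _ hx hy => simpa using hx.add hy
    | smul a x _ hx =>
      have : symMat b (a • x) = (a : ℝ) • symMat b x := (symMat b).map_smul (a : ℝ) x
      rw [this]
      exact hx.smul a.2
  · intro h
    obtain ⟨w, hw⟩ := exists_eq_sum_vecMulVec h
    have : s = ∑ k, symMul (b.equivFun.symm (w k)) (b.equivFun.symm (w k)) := by
      apply symMat_injective b
      rw [hw, map_sum]
      refine Finset.sum_congr rfl fun k _ => ?_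
      rw [symMat_symMul_self]
      have : ⇑(b.repr (b.equivFun.symm (w k))) = w k := by
        rw [← Basis.equivFun_apply, LinearEquiv.apply_symm_apply]
      rw [this]
    rw [this]
    exact Submodule.sum_mem _ fun k _ => symMul_self_mem_psdCone _

end SymmetricSquare

/-! ### Separability of matrices invariant under partial transposition. -/

section Separable

variable {ι κ : Type*}

/-- A positive semidefinite matrix has a symmetric square root `R` with a symmetric
pseudoinverse `T`. -/
theorem exists_sqrt_pseudoinverse [Fintype κ] {A : Matrix κ κ ℝ} (hA : A.PosSemidef) :
    ∃ R T : Matrix κ κ ℝ, R.transpose = R ∧ T.transpose = T ∧ R * R = A ∧ R * T = T * R ∧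
      R * T * R = R ∧ T * R * T = T := by
  classical
  obtain ⟨U, d, hU, hU', rfl⟩ := exists_orthogonal_diagonalization (isSymm_of_posSemidef hA)
  have hd := diag_nonneg_of_posSemidef_conj hU hA
  have hmul (e e' : κ → ℝ) : (U * Matrix.diagonal e * U.transpose) *
      (U * Matrix.diagonal e' * U.transpose) =
      U * Matrix.diagonal (fun i => e i * e' i) * U.transpose := by
    calc _ = U * Matrix.diagonal e * (U.transpose * U) * Matrix.diagonal e' * U.transpose := by
          simp only [Matrix.mul_assoc]
      _ = _ := by
          rw [hU, mul_one, Matrix.mul_assoc U, Matrix.diagonal_mul_diagonal]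
  have htr (e : κ → ℝ) : (U * Matrix.diagonal e * U.transpose).transpose =
      U * Matrix.diagonal e * U.transpose := by
    simp [Matrix.transpose_mul, Matrix.mul_assoc]
  -- The convention `0⁻¹ = 0` makes the second matrix a pseudoinverse on the kernel as well.
  refine ⟨U * Matrix.diagonal (fun i => √(d i)) * U.transpose,
    U * Matrix.diagonal (fun i => (√(d i))⁻¹) * U.transpose, htr _, htr _, ?_, ?_, ?_, ?_⟩
  · rw [hmul]
    simp only [Real.mul_self_sqrt (hd _)]
  · rw [hmul, hmul]
    simp only [mul_comm]
  · rw [hmul, hmul]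
    simp only [mul_inv_mul_cancel]
  · rw [hmul, hmul]
    congr 3
    ext i
    rcases eq_or_ne (√(d i)) 0 with h | h
    · simp [h]
    · field_simp

/-- The vector `(z, 0)` has quadratic value zero, so positivity puts it in the kernel of the whole
block matrix. -/
theorem mulVec_eq_zero_of_fromBlocks [Fintype κ] {A B C : Matrix κ κ ℝ}
    (h : (Matrix.fromBlocks A B B C).PosSemidef) {z : κ → ℝ} (hz : A.mulVec z = 0) :
    B.mulVec z = 0 := by
  have h1 : star (Sum.elim z (0 : κ → ℝ)) ⬝ᵥ
      (Matrix.fromBlocks A B B C).mulVec (Sum.elim z (0 : κ → ℝ)) = 0 := by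
    rw [Matrix.fromBlocks_mulVec]
    simp [hz]
  rw [h.dotProduct_mulVec_zero_iff] at h1
  rw [Matrix.fromBlocks_mulVec] at h1
  ext i
  simpa using congrFun h1 (Sum.inr i)

/-- A positive semidefinite block matrix with symmetric blocks is, up to a positive semidefinite
lower right block, simultaneously diagonalized by a congruence. -/
theorem exists_congruence_of_fromBlocks [Fintype κ] [DecidableEq κ] {A B C : Matrix κ κ ℝ}
    (hB : B.IsSymm) (h : (Matrix.fromBlocks A B B C).PosSemidef) :
    ∃ (W D : Matrix κ κ ℝ) (d : κ → ℝ), A = W * W.transpose ∧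
      B = W * Matrix.diagonal d * W.transpose ∧
      C = W * Matrix.diagonal (fun i => d i ^ 2) * W.transpose + D ∧ D.PosSemidef := by
  have hA : A.PosSemidef := by
    have := h.submatrix Sum.inl
    exact this
  obtain ⟨R, T, hR, hT, hRR, hRT, hRTR, hTRT⟩ := exists_sqrt_pseudoinverse hA
  -- `R * T` projects onto the range of `A`; the columns of `1 - R * T` lie in the kernel of `A`,
  -- hence of `B`.
  have hBP : B * (R * T) = B := by
    have h0 : A * (1 - R * T) = 0 := by
      rw [mul_sub, mul_one, ← hRR, sub_eq_zero, Matrix.mul_assoc R R, hRT, ← Matrix.mul_assoc R T,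
        hRTR]
    have h1 : B * (1 - R * T) = 0 := by
      ext i j
      have hz : A.mulVec ((1 - R * T).col j) = 0 := by
        ext k
        simpa [Matrix.mul_apply, Matrix.mulVec, dotProduct] using congrFun (congrFun h0 k) j
      have := congrFun (mulVec_eq_zero_of_fromBlocks h hz) i
      simpa [Matrix.mul_apply, Matrix.mulVec, dotProduct] using this
    rw [mul_sub, mul_one, sub_eq_zero] at h1
    exact h1.symm
  have hPB : (T * R) * B = B := by
    have := congrArg Matrix.transpose hBP
    rwa [Matrix.transpose_mul, Matrix.transpose_mul, hR, hT, hB.eq] at this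
  -- `X` stands for `A^(-1/2) B A^(-1/2)`. Diagonalizing it by `U` diagonalizes `A = R²` and `B = R
  -- X R` together, with `W = R U`.
  set X := T * B * T with hX
  have hXs : X.IsSymm := by
    rw [Matrix.IsSymm, hX, Matrix.transpose_mul, Matrix.transpose_mul, hT, hB.eq, Matrix.mul_assoc]
  have hRXR : R * X * R = B := by
    calc R * X * R = (R * T) * B * (T * R) := by rw [hX]; simp only [Matrix.mul_assoc]
      _ = B := by rw [hRT, hPB, ← hRT, hBP]
  have hTB : T * B = X * R := by
    rw [hX, Matrix.mul_assoc, ← hRT, Matrix.mul_assoc, hBP]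
  have hBT : B * T = R * X := by
    have := congrArg Matrix.transpose hTB
    rwa [Matrix.transpose_mul, Matrix.transpose_mul, hT, hB.eq, hR, hXs.eq] at this
  have hXTR : X * (T * R) = X := by
    have : T * (T * R) = T := by rw [← hRT, ← Matrix.mul_assoc, hTRT]
    rw [hX, Matrix.mul_assoc, this]
  have hRTX : (R * T) * X = X := by
    have := congrArg Matrix.transpose hXTR
    rwa [Matrix.transpose_mul, Matrix.transpose_mul, hT, hR, hXs.eq] at this
  obtain ⟨U, d, hU, hU', hXU⟩ := exists_orthogonal_diagonalization hXs
  have hXX : X * X = U * Matrix.diagonal (fun i => d i ^ 2) * U.transpose := by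
    calc X * X = U * Matrix.diagonal d * (U.transpose * U) * Matrix.diagonal d * U.transpose := by
          rw [hXU]; simp only [Matrix.mul_assoc]
      _ = _ := by
          rw [hU, mul_one, Matrix.mul_assoc U, Matrix.diagonal_mul_diagonal]
          simp only [sq]
  refine ⟨R * U, C - R * (X * X) * R, d, ?_, ?_, ?_, ?_⟩
  · rw [Matrix.transpose_mul, hR, ← hRR]
    calc R * R = R * (U * U.transpose) * R := by rw [hU', mul_one]
      _ = _ := by simp only [Matrix.mul_assoc]
  · rw [Matrix.transpose_mul, hR, ← hRXR, hXU]
    simp only [Matrix.mul_assoc]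
  · rw [Matrix.transpose_mul, hR, hXX]
    simp only [Matrix.mul_assoc]
    abel
  -- The remainder is the Schur complement: `T * X * R` plays the role of `A⁻¹ B`, and the
  -- congruence eliminates the other blocks.
  · have h2 := h.conjTranspose_mul_mul_same (Matrix.fromRows (-(T * X * R)) 1)
    convert h2 using 1
    rw [Matrix.mul_assoc (Matrix.conjTranspose _), Matrix.fromBlocks_mul_fromRows, Matrix.conjTranspose_fromRows_eq_fromCols_conjTranspose,
      Matrix.fromCols_mul_fromRows]
    simp only [Matrix.conjTranspose_eq_transpose_of_trivial, Matrix.transpose_neg,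
      Matrix.transpose_mul, hT, hR, hXs.eq, Matrix.transpose_one, mul_one, one_mul, mul_neg,
      neg_mul, neg_neg, mul_add]
    have e1 : R * (X * T) * (A * (T * X * R)) = R * (X * X) * R := by
      calc R * (X * T) * (A * (T * X * R)) = R * (X * (T * R)) * ((R * T) * X) * R := by
            rw [← hRR]; simp only [Matrix.mul_assoc]
        _ = _ := by rw [hXTR, hRTX]; simp only [Matrix.mul_assoc]
    have e2 : R * (X * T) * B = R * (X * X) * R := by
      calc R * (X * T) * B = R * X * (T * B) := by simp only [Matrix.mul_assoc]
        _ = _ := by rw [hTB]; simp only [Matrix.mul_assoc]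
    have e3 : B * (T * X * R) = R * (X * X) * R := by
      calc B * (T * X * R) = (B * T) * X * R := by simp only [Matrix.mul_assoc]
        _ = _ := by rw [hBT]; simp only [Matrix.mul_assoc]
    simp only [e1, e2, e3]
    abel

/-- The coordinates of the elementary tensor of two vectors. -/
def prodVec (v : ι → ℝ) (w : κ → ℝ) : ι × κ → ℝ := fun p => v p.1 * w p.2

/-- The cone of separable matrices. -/
def sepCone (ι κ : Type*) : PointedCone ℝ (Matrix (ι × κ) (ι × κ) ℝ) :=
  PointedCone.hull ℝ
    {ρ | ∃ (v : ι → ℝ) (w : κ → ℝ), ρ = Matrix.vecMulVec (prodVec v w) (prodVec v w)}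

theorem vecMulVec_prodVec_mem (v : ι → ℝ) (w : κ → ℝ) :
    Matrix.vecMulVec (prodVec v w) (prodVec v w) ∈ sepCone ι κ :=
  Submodule.subset_span ⟨v, w, rfl⟩

theorem mem_sepCone_of_swap {ρ : Matrix (ι × κ) (ι × κ) ℝ}
    (h : ρ.submatrix Prod.swap Prod.swap ∈ sepCone κ ι) : ρ ∈ sepCone ι κ := by
  suffices ∀ σ ∈ sepCone κ ι, σ.submatrix Prod.swap Prod.swap ∈ sepCone ι κ by
    simpa using this _ h
  intro σ hσ
  induction hσ using Submodule.span_induction with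
  | mem x h =>
    obtain ⟨v, w, rfl⟩ := h
    convert vecMulVec_prodVec_mem w v using 1
    ext p q
    simp only [Matrix.submatrix_apply, Matrix.vecMulVec_apply, prodVec, Prod.fst_swap,
      Prod.snd_swap]
    ring
  | zero => exact Submodule.zero_mem _
  | add x y _ _ hx hy => exact Submodule.add_mem _ hx hy
  | smul a x _ hx => exact Submodule.smul_mem _ a hx

/-- Invariance makes the off-diagonal block symmetric. The columns `W_i` of the congruence then give
the elementary tensors `(1, d_i) ⊗ W_i`, and the positive remainder gives tensors `(0, 1) ⊗ u_i`. -/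
theorem mem_sepCone_fin_two [Fintype κ] {ρ : Matrix (Fin 2 × κ) (Fin 2 × κ) ℝ}
    (hρ : ρ.PosSemidef) (hpt : ∀ i j k l, ρ (i, k) (j, l) = ρ (j, k) (i, l)) :
    ρ ∈ sepCone (Fin 2) κ := by
  classical
  have hs := isSymm_of_posSemidef hρ
  have hblock : (Matrix.fromBlocks (Matrix.of fun k l => ρ (0, k) (0, l))
      (Matrix.of fun k l => ρ (0, k) (1, l)) (Matrix.of fun k l => ρ (0, k) (1, l))
      (Matrix.of fun k l => ρ (1, k) (1, l))).PosSemidef := by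
    convert hρ.submatrix (Sum.elim (fun k => ((0 : Fin 2), k)) (fun k => ((1 : Fin 2), k))) using 1
    ext i j
    rcases i with i | i <;> rcases j with j | j <;> simp
    exact hpt _ _ _ _
  have hB : (Matrix.of fun k l => ρ (0, k) (1, l)).IsSymm := by
    ext k l
    simp only [Matrix.transpose_apply, Matrix.of_apply]
    rw [hpt, hs.apply]
  obtain ⟨W, D, d, hA, hB, hC, hD⟩ := exists_congruence_of_fromBlocks hB hblock
  obtain ⟨u, rfl⟩ := exists_eq_sum_vecMulVec hD
  have key : ρ = (∑ i, Matrix.vecMulVec (prodVec ![1, d i] (W.col i)) (prodVec ![1, d i] (W.col i)))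
      + ∑ i, Matrix.vecMulVec (prodVec ![0, 1] (u i)) (prodVec ![0, 1] (u i)) := by
    have e00 : ∀ k l, ρ (0, k) (0, l) = ∑ i, W k i * W l i := fun k l => by
      simpa [Matrix.mul_apply] using congrFun (congrFun hA k) l
    have e01 : ∀ k l, ρ (0, k) (1, l) = ∑ i, W k i * d i * W l i := fun k l => by
      have := congrFun (congrFun hB k) l
      rw [Matrix.mul_apply] at this
      simpa [Matrix.mul_diagonal] using this
    have e11 : ∀ k l, ρ (1, k) (1, l) = (∑ i, W k i * d i ^ 2 * W l i) + ∑ i, u i k * u i l :=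
      fun k l => by
      have := congrFun (congrFun hC k) l
      rw [Matrix.add_apply, Matrix.mul_apply] at this
      simpa [Matrix.mul_diagonal, Matrix.sum_apply, Matrix.vecMulVec_apply] using this
    ext ⟨i, k⟩ ⟨j, l⟩
    simp only [Matrix.add_apply, Matrix.sum_apply, Matrix.vecMulVec_apply, prodVec,
      Matrix.col_apply]
    fin_cases i <;> fin_cases j
    · simpa using e00 k l
    · simp only [Fin.zero_eta, Fin.mk_one, e01]
      simp
      exact Finset.sum_congr rfl fun i _ => by ring
    · simp only [Fin.zero_eta, Fin.mk_one, hpt 1 0, e01]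
      simp
      exact Finset.sum_congr rfl fun i _ => by ring
    · simp only [Fin.mk_one, e11]
      simp
      exact Finset.sum_congr rfl fun i _ => by ring
  rw [key]
  exact Submodule.add_mem _ (Submodule.sum_mem _ fun _ _ => vecMulVec_prodVec_mem _ _)
    (Submodule.sum_mem _ fun _ _ => vecMulVec_prodVec_mem _ _)

theorem mem_sepCone_of_left_le_two {m : ℕ} [Fintype κ] (hm : m ≤ 2)
    {ρ : Matrix (Fin m × κ) (Fin m × κ) ℝ}
    (hρ : ρ.PosSemidef) (hpt : ∀ i j k l, ρ (i, k) (j, l) = ρ (j, k) (i, l)) :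
    ρ ∈ sepCone (Fin m) κ := by
  interval_cases m
  · have : ρ = 0 := by ext ⟨i, _⟩; exact i.elim0
    rw [this]
    exact Submodule.zero_mem _
  · have h1 := hρ.submatrix (fun k : κ => ((0 : Fin 1), k))
    obtain ⟨u, hu⟩ := exists_eq_sum_vecMulVec h1
    have : ρ = ∑ i, Matrix.vecMulVec (prodVec 1 (u i)) (prodVec 1 (u i)) := by
      ext ⟨i, k⟩ ⟨j, l⟩
      have := congrFun (congrFun hu k) l
      fin_cases i
      fin_cases j
      simpa [Matrix.sum_apply, Matrix.vecMulVec_apply, prodVec] using this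
    rw [this]
    exact Submodule.sum_mem _ fun _ _ => vecMulVec_prodVec_mem _ _
  · exact mem_sepCone_fin_two hρ hpt

/-- If one of the factors has dimension at most two, then a positive semidefinite matrix that is
invariant under partial transposition is separable. -/
theorem mem_sepCone_of_min_le_two {m n : ℕ} (hmn : min m n ≤ 2)
    {ρ : Matrix (Fin m × Fin n) (Fin m × Fin n) ℝ}
    (hρ : ρ.PosSemidef) (hpt : ∀ i j k l, ρ (i, k) (j, l) = ρ (j, k) (i, l)) :
    ρ ∈ sepCone (Fin m) (Fin n) := by
  rcases min_le_iff.1 hmn with hm | hn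
  · exact mem_sepCone_of_left_le_two hm hρ hpt
  · apply mem_sepCone_of_swap
    refine mem_sepCone_of_left_le_two hn (hρ.submatrix _) fun i j k l => ?_
    have hs := isSymm_of_posSemidef hρ
    simp only [Matrix.submatrix_apply, Prod.swap_prod_mk]
    -- Transposing the second factor is transposing the first and then the whole matrix.
    rw [hpt, hs.apply]

end Separable

/-! ### Almost compact, spectrahedral and SDR cones from matrix inequalities. -/

section Cones

theorem isClosed_setOf_posSemidef {ι : Type*} [Finite ι] : IsClosed {A : Matrix ι ι ℝ | A.PosSemidef} := by
  cases nonempty_fintype ι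
  have : {A : Matrix ι ι ℝ | A.PosSemidef} = {A | A.conjTranspose = A} ∩
      ⋂ x : ι → ℝ, {A | 0 ≤ star x ⬝ᵥ (A.mulVec x)} := by
    ext A
    simp [Matrix.posSemidef_iff_dotProduct_mulVec, Matrix.IsHermitian]
  rw [this]
  refine (isClosed_eq (by fun_prop) (by fun_prop)).inter (isClosed_iInter fun x => ?_)
  exact isClosed_le continuous_const (by fun_prop)

variable {E E' : Type*} [AddCommGroup E] [Module ℝ E] [AddCommGroup E'] [Module ℝ E']
  {ι : Type*} [Fintype ι]

theorem isClosed_preimage_moduleTopology {G : Type*} [AddCommGroup G] [Module ℝ G]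
    [TopologicalSpace G] [ContinuousAdd G] [ContinuousSMul ℝ G] (L : E →ₗ[ℝ] G) {S : Set G}
    (hS : IsClosed S) : @IsClosed E (moduleTopology ℝ E) (L ⁻¹' S) := by
  let : TopologicalSpace E := moduleTopology ℝ E
  have : IsModuleTopology ℝ E := ⟨rfl⟩
  exact hS.preimage (IsModuleTopology.continuous_of_linearMap L)

/-- Separation of a point from a closed cone in a finite-dimensional space. -/
theorem exists_dual_neg_of_notMem [FiniteDimensional ℝ E] {C : PointedCone ℝ E}
    (hC : @IsClosed E (moduleTopology ℝ E) (C : Set E)) {x : E} (hx : x ∉ C) :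
    ∃ l : Dual ℝ E, (∀ c ∈ C, 0 ≤ l c) ∧ l x < 0 := by
  let : TopologicalSpace E := moduleTopology ℝ E
  have : IsModuleTopology ℝ E := ⟨rfl⟩
  have : ContinuousAdd E := IsModuleTopology.toContinuousAdd ℝ E
  let e := (finBasis ℝ E).equivFun
  have hcont : Continuous e.symm :=
    IsModuleTopology.continuous_of_linearMap (e.symm : (Fin (finrank ℝ E) → ℝ) →ₗ[ℝ] E)
  let K : ProperCone ℝ (Fin (finrank ℝ E) → ℝ) :=
    { (C.comap (e.symm : (Fin (finrank ℝ E) → ℝ) →ₗ[ℝ] E)) with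
      isClosed' := hC.preimage hcont }
  have hK (y) : y ∈ K ↔ e.symm y ∈ C := Iff.rfl
  obtain ⟨f, hf, hfx⟩ := K.hyperplane_separation_point (x₀ := e x) (by simpa [hK] using hx)
  exact ⟨f.toLinearMap ∘ₗ (e : E →ₗ[ℝ] _), fun c hc => hf _ (by simpa [hK] using hc), hfx⟩

/-- This bound makes the slices of bounded trace compact. -/
theorem abs_apply_le_trace {A : Matrix ι ι ℝ} (hA : A.PosSemidef) (i j : ι) :
    |A i j| ≤ A.trace := by
  obtain ⟨w, rfl⟩ := exists_eq_sum_vecMulVec hA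
  simp only [Matrix.sum_apply, Matrix.vecMulVec_apply, Matrix.trace, Matrix.diag_apply]
  rw [Finset.sum_comm]
  refine (Finset.abs_sum_le_sum_abs _ _).trans (Finset.sum_le_sum fun k _ => ?_)
  have h1 := Finset.single_le_sum (f := fun i => w k i * w k i) (fun i _ => mul_self_nonneg _)
    (Finset.mem_univ i)
  have h2 := Finset.single_le_sum (f := fun i => w k i * w k i) (fun i _ => mul_self_nonneg _)
    (Finset.mem_univ j)
  rw [abs_le]
  constructor <;> nlinarith [sq_nonneg (w k i - w k j), sq_nonneg (w k i + w k j)]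

/-- The linear image of a closed set of positive semidefinite matrices is closed if the trace
factors through the linear map on that set. -/
theorem isClosed_image_of_trace [FiniteDimensional ℝ E] {K : Set (Matrix ι ι ℝ)} (hK : IsClosed K)
    (hpsd : ∀ A ∈ K, A.PosSemidef) (T : Matrix ι ι ℝ →ₗ[ℝ] E) (φ : Dual ℝ E)
    (hφ : ∀ A ∈ K, φ (T A) = A.trace) : @IsClosed E (moduleTopology ℝ E) (T '' K) := by
  let e := (finBasis ℝ E).equivFun
  let T' : Matrix ι ι ℝ →ₗ[ℝ] (Fin (finrank ℝ E) → ℝ) := e.toLinearMap ∘ₗ T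
  let φ' : (Fin (finrank ℝ E) → ℝ) →ₗ[ℝ] ℝ := φ ∘ₗ e.symm.toLinearMap
  have hφ' : ∀ A ∈ K, φ' (T' A) = A.trace := fun A hA => by simp [φ', T', hφ A hA]
  have : IsModuleTopology ℝ (Matrix ι ι ℝ) := inferInstanceAs (IsModuleTopology ℝ (ι → ι → ℝ))
  have hT' : Continuous T' := IsModuleTopology.continuous_of_linearMap T'
  have hφc : Continuous φ' := IsModuleTopology.continuous_of_linearMap φ'
  have hcompact (c : ℝ) : IsCompact (K ∩ {A | A.trace ≤ c}) := by
    have hbox : IsCompact (Set.pi Set.univ fun _ : ι => Set.pi Set.univ fun _ : ι =>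
        Set.Icc (-c) c) :=
      isCompact_univ_pi fun _ => isCompact_univ_pi fun _ => isCompact_Icc
    refine IsCompact.of_isClosed_subset hbox
      (hK.inter (isClosed_le (by fun_prop) continuous_const)) ?_
    rintro A ⟨hA, hAc⟩ i _ j _
    exact abs_le.1 ((abs_apply_le_trace (hpsd A hA) i j).trans hAc)
  have hclosed : IsClosed (T' '' K) := by
    refine isClosed_of_closure_subset fun y hy => ?_
    have hc := ((hcompact (φ' y + 1)).image hT').isClosed
    have hmem : y ∈ closure (T' '' (K ∩ {A | A.trace ≤ φ' y + 1})) := by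
      rw [mem_closure_iff] at hy ⊢
      intro U hU hyU
      -- Near `y` the functional is below `φ' y + 1`, so only preimages of bounded trace matter.
      obtain ⟨_, ⟨hzU, hzφ⟩, A, hA, rfl⟩ := hy (U ∩ {z | φ' z < φ' y + 1})
        (hU.inter (isOpen_lt hφc continuous_const)) ⟨hyU, by simp⟩
      refine ⟨_, hzU, A, ⟨hA, ?_⟩, rfl⟩
      rw [Set.mem_ofPred_eq, hφ' A hA] at hzφ
      exact hzφ.le
    rw [hc.closure_eq] at hmem
    exact Set.image_mono Set.inter_subset_left hmem
  have : T '' K = e.toLinearMap ⁻¹' (T' '' K) := by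
    ext y
    simp [T']
  rw [this]
  exact isClosed_preimage_moduleTopology _ hclosed

/-- The trace exposes the origin: a positive semidefinite matrix of trace zero vanishes. -/
theorem isAlmostCompact_of_matrix [FiniteDimensional ℝ E] {C : PointedCone ℝ E}
    (M : E →ₗ[ℝ] Matrix ι ι ℝ) (hM : Function.Injective M)
    (hC : ∀ x, x ∈ C ↔ (M x).PosSemidef) (hfull : Submodule.span ℝ (C : Set E) = ⊤) :
    IsAlmostCompact C where
  finite := inferInstance
  pointed := by
    refine ⟨Matrix.traceLinearMap ι ℝ ℝ ∘ₗ M, fun c hc => ((hC c).1 hc).trace_nonneg, ?_⟩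
    ext x
    simp only [Submodule.bot_coe, Set.mem_singleton_iff, Set.mem_ofPred_eq, LinearMap.comp_apply,
      Matrix.traceLinearMap_apply]
    constructor
    · rintro rfl
      exact ⟨C.zero_mem, by simp⟩
    · rintro ⟨hx, h0⟩
      rw [((hC x).1 hx).trace_eq_zero_iff] at h0
      exact hM (by rw [h0, map_zero])
  closed := by
    have : (C : Set E) = M ⁻¹' {A | A.PosSemidef} := by
      ext x
      exact hC x
    rw [this]
    exact isClosed_preimage_moduleTopology _ isClosed_setOf_posSemidef
  full := hfull

/-- The image of a cone of positive semidefinite matrices under a surjective linear map is almost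
compact if the trace factors through the linear map. -/
theorem isAlmostCompact_map [FiniteDimensional ℝ E] {C : PointedCone ℝ E'}
    (M : E' →ₗ[ℝ] Matrix ι ι ℝ) (hM : Function.Injective M)
    (hC : ∀ x, x ∈ C ↔ (M x).PosSemidef) (hfull : Submodule.span ℝ (C : Set E') = ⊤)
    (T : E' →ₗ[ℝ] E) (hT : Function.Surjective T) (φ : Dual ℝ E)
    (hφ : ∀ x, φ (T x) = (M x).trace) : IsAlmostCompact (C.map T) where
  finite := inferInstance
  pointed := by
    refine ⟨φ, ?_, ?_⟩
    · intro c hc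
      obtain ⟨x, hx, rfl⟩ := PointedCone.mem_map.1 hc
      rw [hφ]
      exact ((hC x).1 hx).trace_nonneg
    · ext y
      simp only [Submodule.bot_coe, Set.mem_singleton_iff, Set.mem_ofPred_eq]
      constructor
      · rintro rfl
        exact ⟨Submodule.zero_mem _, by simp⟩
      · rintro ⟨hy, h0⟩
        obtain ⟨x, hx, rfl⟩ := PointedCone.mem_map.1 hy
        rw [hφ, ((hC x).1 hx).trace_eq_zero_iff] at h0
        rw [hM (h0.trans (map_zero M).symm), map_zero]
  closed := by
    obtain ⟨N, hN⟩ := M.exists_leftInverse_of_injective (LinearMap.ker_eq_bot.2 hM)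
    have hNM (x : E') : N (M x) = x := LinearMap.congr_fun hN x
    have : IsModuleTopology ℝ (Matrix ι ι ℝ) := inferInstanceAs (IsModuleTopology ℝ (ι → ι → ℝ))
    -- The equation `M (N A) = A` says that `A` lies in the range of `M`, as a closed condition.
    have hK : IsClosed {A : Matrix ι ι ℝ | A.PosSemidef ∧ M (N A) = A} :=
      isClosed_setOf_posSemidef.inter
        (isClosed_eq (IsModuleTopology.continuous_of_linearMap (M ∘ₗ N)) continuous_id)
    have h := isClosed_image_of_trace hK (fun A hA => hA.1) (T ∘ₗ N) φ (fun A hA => by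
      rw [LinearMap.comp_apply, hφ, hA.2])
    convert h using 1
    ext y
    simp only [SetLike.mem_coe, PointedCone.mem_map, Set.mem_image, Set.mem_ofPred_eq,
      LinearMap.comp_apply]
    constructor
    · rintro ⟨x, hx, rfl⟩
      exact ⟨M x, ⟨(hC x).1 hx, by rw [hNM]⟩, by rw [hNM]⟩
    · rintro ⟨A, ⟨hA, hA'⟩, rfl⟩
      exact ⟨N A, (hC _).2 (by rwa [hA']), rfl⟩
  full := by
    rw [PointedCone.coe_map, Submodule.span_image, hfull, Submodule.map_top,
      LinearMap.range_eq_top.2 hT]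

theorem isSpectrahedralCone_of_matrix [FiniteDimensional ℝ E] {C : PointedCone ℝ E}
    (M : E →ₗ[ℝ] Matrix ι ι ℝ) (hM : Function.Injective M) (hsymm : ∀ x, (M x).IsSymm)
    (hC : ∀ x, x ∈ C ↔ (M x).PosSemidef) (hfull : Submodule.span ℝ (C : Set E) = ⊤) :
    IsSpectrahedralCone C := by
  refine ⟨isAlmostCompact_of_matrix M hM hC hfull, Fintype.card ι, ?_⟩
  let e := Fintype.equivFin ι
  let b := (Pi.basisFun ℝ (Fin (Fintype.card ι))).dualBasis
  let ψ := matSym b ∘ₗ (Matrix.reindexLinearEquiv ℝ ℝ e e).toLinearMap ∘ₗ M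
  have hψ (x : E) : symMat b (ψ x) = Matrix.reindex e e (M x) :=
    symMat_matSym b (by
      change (Matrix.reindex e e (M x)).IsSymm
      simpa using (hsymm x).submatrix e.symm)
  refine ⟨ψ, fun x y hxy => hM ?_, ?_⟩
  · have := congrArg (symMat b) hxy
    rw [hψ, hψ] at this
    exact (Matrix.reindex e e).injective this
  · ext x
    rw [PointedCone.mem_comap, mem_psdCone_iff b, hψ, hC, Matrix.reindex_apply,
      Matrix.posSemidef_submatrix_equiv]

theorem isSpectrahedron_of_matrix {S : Set E} (M : E →ₗ[ℝ] Matrix ι ι ℝ)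
    (hsymm : ∀ x, (M x).IsSymm) (hS : ∀ x, x ∈ S ↔ (M x).PosSemidef) : IsSpectrahedron S := by
  let e := Fintype.equivFin ι
  refine ⟨Fintype.card ι, 0, (Matrix.reindexLinearEquiv ℝ ℝ e e).toLinearMap ∘ₗ M,
    Matrix.isSymm_zero, fun x => ?_, ?_⟩
  · simpa using (hsymm x).submatrix e.symm
  · ext x
    rw [hS]
    simp [Matrix.posSemidef_submatrix_equiv]

theorem isSDRCone_of_image [FiniteDimensional ℝ E'] {D : PointedCone ℝ E} {C : PointedCone ℝ E'}
    (hD : IsAlmostCompact D)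
    (M : E' →ₗ[ℝ] Matrix ι ι ℝ) (hM : Function.Injective M) (hsymm : ∀ x, (M x).IsSymm)
    (hC : ∀ x, x ∈ C ↔ (M x).PosSemidef) (hfull : Submodule.span ℝ (C : Set E') = ⊤)
    (T : E' →ₗ[ℝ] E) (hT : C.map T = D) : IsSDRCone D := by
  let e := (finBasis ℝ E').equivFun
  refine ⟨hD, finrank ℝ E', C.comap e.symm.toLinearMap, T ∘ₗ e.symm.toLinearMap, ?_, ?_⟩
  · refine isSpectrahedralCone_of_matrix (M ∘ₗ e.symm.toLinearMap) ?_ (fun x => hsymm _)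
      (fun x => hC _) ?_
    · exact hM.comp e.symm.injective
    · have : ((C.comap e.symm.toLinearMap : PointedCone ℝ _) : Set (Fin (finrank ℝ E') → ℝ)) =
          e.toLinearMap '' (C : Set E') := by
        ext x
        simp only [PointedCone.coe_comap, Set.mem_preimage, Set.mem_image, SetLike.mem_coe,
          LinearEquiv.coe_coe]
        constructor
        · intro h
          exact ⟨_, h, by simp⟩
        · rintro ⟨y, hy, rfl⟩
          simpa using hy
      rw [this, Submodule.span_image, hfull, Submodule.map_top, LinearEquiv.range]
  · rw [← hT]
    ext y
    simp only [PointedCone.mem_map, PointedCone.mem_comap]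
    constructor
    · rintro ⟨x, hx, rfl⟩
      exact ⟨_, hx, rfl⟩
    · rintro ⟨x, hx, rfl⟩
      exact ⟨e x, by simpa using hx, by simp⟩

theorem posSemidef_fromBlocks_zero_iff {κ : Type*} [Fintype κ] {A : Matrix ι ι ℝ}
    {D : Matrix κ κ ℝ} :
    (Matrix.fromBlocks A 0 0 D).PosSemidef ↔ A.PosSemidef ∧ D.PosSemidef := by
  refine ⟨fun h => ⟨h.submatrix Sum.inl, h.submatrix Sum.inr⟩, fun ⟨hA, hD⟩ => ?_⟩
  refine Matrix.PosSemidef.of_dotProduct_mulVec_nonneg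
    (Matrix.IsHermitian.fromBlocks hA.1 (by simp) hD.1) fun x => ?_
  rw [Matrix.fromBlocks_mulVec]
  have h1 := hA.dotProduct_mulVec_nonneg (x ∘ Sum.inl)
  have h2 := hD.dotProduct_mulVec_nonneg (x ∘ Sum.inr)
  simp only [dotProduct, Fintype.sum_sum_type] at h1 h2 ⊢
  simpa using add_nonneg h1 h2

/-- The equation `T x = y` becomes a matrix inequality by placing the coordinates of `y - T x` and
their negatives on diagonal blocks. -/
theorem isSDRSet_of_image [FiniteDimensional ℝ E] [FiniteDimensional ℝ E'] {S : Set E}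
    (M : E' →ₗ[ℝ] Matrix ι ι ℝ) (hsymm : ∀ x, (M x).IsSymm) (T : E' →ₗ[ℝ] E)
    (hS : ∀ y, y ∈ S ↔ ∃ x, (M x).PosSemidef ∧ T x = y) : IsSDRSet S := by
  classical
  let e := (finBasis ℝ E').equivFun
  let g := (finBasis ℝ E).equivFun
  let κ := Fin (finrank ℝ E)
  let J := ι ⊕ (κ ⊕ κ)
  let N : Matrix ι ι ℝ × (κ → ℝ) →ₗ[ℝ] Matrix J J ℝ :=
    { toFun := fun p => Matrix.fromBlocks p.1 0 0
        (Matrix.fromBlocks (Matrix.diagonal p.2) 0 0 (Matrix.diagonal (-p.2)))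
      map_add' := fun p q => by
        rw [Matrix.fromBlocks_add, Matrix.fromBlocks_add, Matrix.diagonal_add, Matrix.diagonal_add]
        simp only [add_zero, Prod.fst_add, Prod.snd_add, neg_add]
        rfl
      map_smul' := fun c p => by
        rw [Matrix.fromBlocks_smul, Matrix.fromBlocks_smul, ← Matrix.diagonal_smul,
          ← Matrix.diagonal_smul]
        simp only [smul_zero, Prod.smul_fst, Prod.smul_snd, smul_neg, RingHom.id_apply] }
  have hN (p) : (N p).PosSemidef ↔ p.1.PosSemidef ∧ p.2 = 0 := by
    change (Matrix.fromBlocks p.1 0 0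
        (Matrix.fromBlocks (Matrix.diagonal p.2) 0 0 (Matrix.diagonal (-p.2)))).PosSemidef ↔ _
    rw [posSemidef_fromBlocks_zero_iff, posSemidef_fromBlocks_zero_iff,
      Matrix.posSemidef_diagonal_iff, Matrix.posSemidef_diagonal_iff]
    refine and_congr_right fun _ => ⟨fun h => ?_, fun h => by simp [h]⟩
    ext i
    have h1 := h.1 i
    have h2 := h.2 i
    simp only [Pi.neg_apply] at h2
    simpa using le_antisymm (by linarith) h1
  have hNs (p) (hp : p.1.IsSymm) : (N p).IsSymm := by
    refine Matrix.IsSymm.fromBlocks hp (by simp) ?_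
    exact Matrix.IsSymm.fromBlocks (Matrix.isSymm_diagonal _) (by simp) (Matrix.isSymm_diagonal _)
  let j := Fintype.equivFin J
  let r := (Matrix.reindexLinearEquiv ℝ ℝ j j).toLinearMap
  have hr (A : Matrix J J ℝ) : (r A).PosSemidef ↔ A.PosSemidef := by
    change (Matrix.reindex j j A).PosSemidef ↔ _
    rw [Matrix.reindex_apply, Matrix.posSemidef_submatrix_equiv]
  have hrs (A : Matrix J J ℝ) (hA : A.IsSymm) : (r A).IsSymm := hA.submatrix j.symm
  refine ⟨Fintype.card J, finrank ℝ E', 0, r ∘ₗ N ∘ₗ LinearMap.prod 0 g.toLinearMap,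
    r ∘ₗ N ∘ₗ LinearMap.prod (M ∘ₗ e.symm.toLinearMap)
      (-(g.toLinearMap ∘ₗ T ∘ₗ e.symm.toLinearMap)),
    Matrix.isSymm_zero, fun x => hrs _ (hNs _ Matrix.isSymm_zero),
    fun y => hrs _ (hNs _ (hsymm _)), ?_⟩
  ext y
  rw [hS, Set.mem_ofPred_eq]
  have key (x : Fin (finrank ℝ E') → ℝ) :
      (0 + (r ∘ₗ N ∘ₗ LinearMap.prod 0 g.toLinearMap) y +
        (r ∘ₗ N ∘ₗ LinearMap.prod (M ∘ₗ e.symm.toLinearMap)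
          (-(g.toLinearMap ∘ₗ T ∘ₗ e.symm.toLinearMap))) x).PosSemidef ↔
      (M (e.symm x)).PosSemidef ∧ T (e.symm x) = y := by
    rw [zero_add, LinearMap.comp_apply, LinearMap.comp_apply, LinearMap.comp_apply r,
      LinearMap.comp_apply N, ← map_add, ← map_add, hr, hN]
    change (0 + M (e.symm x)).PosSemidef ∧ g y + -(g (T (e.symm x))) = 0 ↔ _
    rw [zero_add]
    refine and_congr_right fun _ => ?_
    rw [← sub_eq_add_neg, sub_eq_zero, g.injective.eq_iff, eq_comm]
  simp only [key]
  exact e.symm.surjective.exists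

end Cones

/-! ### The tensor cone as a cone of matrices. -/

section TensorCone

variable {V W : Type*} [AddCommGroup V] [Module ℝ V] [AddCommGroup W] [Module ℝ W]
  {ι κ : Type*}

theorem minTensorProduct_psdCone :
    (psdCone V).minTensorProduct (psdCone W) = PointedCone.hull ℝ
      {x : Sym[ℝ]^2 V ⊗[ℝ] Sym[ℝ]^2 W | ∃ v w, x = symMul v v ⊗ₜ symMul w w} := by
  refine le_antisymm (Submodule.span_le.2 ?_) (Submodule.span_le.2 ?_)
  · rintro _ ⟨x, hx, y, hy, rfl⟩
    simp only [SetLike.mem_coe] at hx hy ⊢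
    induction hx using Submodule.span_induction with
    | mem x h =>
      obtain ⟨v, rfl⟩ := h
      induction hy using Submodule.span_induction with
      | mem y h =>
        obtain ⟨w, rfl⟩ := h
        exact Submodule.subset_span ⟨v, w, by simp only [tprod_eq_symMul]⟩
      | zero => rw [TensorProduct.tmul_zero]; exact Submodule.zero_mem _
      | add x y _ _ hx hy => rw [TensorProduct.tmul_add]; exact Submodule.add_mem _ hx hy
      | smul a y _ hy =>
        convert Submodule.smul_mem _ a hy using 1
        exact TensorProduct.tmul_smul (a : ℝ) _ y
    | zero => rw [TensorProduct.zero_tmul]; exact Submodule.zero_mem _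
    | add x y _ _ hx hy => rw [TensorProduct.add_tmul]; exact Submodule.add_mem _ hx hy
    | smul a x _ hx =>
      convert Submodule.smul_mem _ a hx using 1
      exact (TensorProduct.smul_tmul' (a : ℝ) x y).symm
  · rintro _ ⟨v, w, rfl⟩
    exact PointedCone.tmul_mem_minTensorProduct (symMul_self_mem_psdCone v)
      (symMul_self_mem_psdCone w)

theorem sq_tmul_sq_mem (v : V) (w : W) :
    symMul v v ⊗ₜ symMul w w ∈ (psdCone V).minTensorProduct (psdCone W) :=
  PointedCone.tmul_mem_minTensorProduct (symMul_self_mem_psdCone v) (symMul_self_mem_psdCone w)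

theorem minTensorProduct_psdCone_induction {p : Sym[ℝ]^2 V ⊗[ℝ] Sym[ℝ]^2 W → Prop}
    (hsq : ∀ v w, p (symMul v v ⊗ₜ symMul w w)) (hzero : p 0)
    (hadd : ∀ x y, p x → p y → p (x + y)) (hsmul : ∀ (c : ℝ) x, 0 ≤ c → p x → p (c • x))
    {x : Sym[ℝ]^2 V ⊗[ℝ] Sym[ℝ]^2 W} (hx : x ∈ (psdCone V).minTensorProduct (psdCone W)) :
    p x := by
  rw [minTensorProduct_psdCone] at hx
  induction hx using Submodule.span_induction with
  | mem x h => obtain ⟨v, w, rfl⟩ := h; exact hsq v w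
  | zero => exact hzero
  | add x y _ _ hx hy => exact hadd x y hx hy
  | smul a x _ hx => exact hsmul a x a.2 hx

theorem span_minTensorProduct_psdCone :
    Submodule.span ℝ ((psdCone V).minTensorProduct (psdCone W) :
      Set (Sym[ℝ]^2 V ⊗[ℝ] Sym[ℝ]^2 W)) = ⊤ := by
  rw [eq_top_iff, ← TensorProduct.map₂_mk_top_top_eq_top, ← span_symMul_self, ← span_symMul_self,
    Submodule.map₂_span_span, Submodule.span_le]
  rintro _ ⟨_, ⟨v, rfl⟩, _, ⟨w, rfl⟩, rfl⟩
  exact Submodule.subset_span (sq_tmul_sq_mem v w)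

/-- The matrix of an element of `Sym² V ⊗ Sym² W` as a symmetric form on the dual of `V ⊗ W`. -/
def tensorMat (b : Basis ι ℝ V) (c : Basis κ ℝ W) :
    Sym[ℝ]^2 V ⊗[ℝ] Sym[ℝ]^2 W →ₗ[ℝ] Matrix (ι × κ) (ι × κ) ℝ :=
  TensorProduct.lift (LinearMap.mk₂ ℝ
    (fun x y => Matrix.of fun p q => symMat b x p.1 q.1 * symMat c y p.2 q.2)
    (fun x x' y => by ext; simp; ring) (fun r x y => by ext; simp; ring)
    (fun x y y' => by ext; simp; ring) (fun r x y => by ext; simp; ring))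

theorem tensorMat_tmul (b : Basis ι ℝ V) (c : Basis κ ℝ W) (x : Sym[ℝ]^2 V) (y : Sym[ℝ]^2 W)
    (p q : ι × κ) : tensorMat b c (x ⊗ₜ y) p q = symMat b x p.1 q.1 * symMat c y p.2 q.2 := by
  simp [tensorMat]

theorem tensorMat_sq (b : Basis ι ℝ V) (c : Basis κ ℝ W) (v : V) (w : W) :
    tensorMat b c (symMul v v ⊗ₜ symMul w w) =
      Matrix.vecMulVec (prodVec (b.repr v) (c.repr w)) (prodVec (b.repr v) (c.repr w)) := by
  ext p q
  rw [tensorMat_tmul, symMat_symMul_self, symMat_symMul_self]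
  simp only [Matrix.vecMulVec_apply, prodVec]
  ring

theorem tensorMat_isSymm (b : Basis ι ℝ V) (c : Basis κ ℝ W)
    (x : Sym[ℝ]^2 V ⊗[ℝ] Sym[ℝ]^2 W) : (tensorMat b c x).IsSymm := by
  induction x using TensorProduct.induction_on with
  | zero => simp
  | tmul x y =>
    ext p q
    rw [Matrix.transpose_apply, tensorMat_tmul, tensorMat_tmul]
    have h1 := congrFun (congrFun (symMat_transpose b x) p.1) q.1
    have h2 := congrFun (congrFun (symMat_transpose c y) p.2) q.2
    rw [Matrix.transpose_apply] at h1 h2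
    rw [h1, h2]
  | add x y hx hy => rw [map_add]; exact hx.add hy

/-- Symmetry in one factor alone, beyond symmetry of the whole matrix, is what the separability
criterion needs. -/
theorem tensorMat_partialTranspose (b : Basis ι ℝ V) (c : Basis κ ℝ W)
    (x : Sym[ℝ]^2 V ⊗[ℝ] Sym[ℝ]^2 W) (i j : ι) (k l : κ) :
    tensorMat b c x (i, k) (j, l) = tensorMat b c x (j, k) (i, l) := by
  induction x using TensorProduct.induction_on with
  | zero => simp
  | tmul x y =>
    rw [tensorMat_tmul, tensorMat_tmul]
    have h1 := congrFun (congrFun (symMat_transpose b x) i) j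
    rw [Matrix.transpose_apply] at h1
    rw [h1]
  | add x y hx hy => rw [map_add, Matrix.add_apply, hx, hy, Matrix.add_apply]

variable [Fintype ι] [Fintype κ]

theorem tensorMat_injective (b : Basis ι ℝ V) (c : Basis κ ℝ W) :
    Function.Injective (tensorMat b c) := by
  let N : Matrix (ι × κ) (ι × κ) ℝ →ₗ[ℝ] Sym[ℝ]^2 V ⊗[ℝ] Sym[ℝ]^2 W :=
    ∑ k, ∑ l, ∑ i, ∑ j, (Matrix.entryLinearMap ℝ ℝ (i, k) (j, l)).smulRight
      (symMul (b i) (b j) ⊗ₜ symMul (c k) (c l))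
  have h : N ∘ₗ tensorMat b c = LinearMap.id := by
    ext x y
    simp only [TensorProduct.AlgebraTensorModule.curry_apply, LinearMap.restrictScalars_self,
      TensorProduct.curry_apply, LinearMap.comp_apply, LinearMap.id_apply]
    conv_rhs => rw [← matSym_symMat b x, ← matSym_symMat c y, matSym_apply, matSym_apply]
    simp only [N, LinearMap.sum_apply, LinearMap.smulRight_apply, Matrix.entryLinearMap_apply,
      tensorMat_tmul, TensorProduct.sum_tmul, TensorProduct.tmul_sum, TensorProduct.smul_tmul_smul]
  exact Function.LeftInverse.injective (g := N) fun x => LinearMap.congr_fun h x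

theorem posSemidef_tensorMat (b : Basis ι ℝ V) (c : Basis κ ℝ W)
    {x : Sym[ℝ]^2 V ⊗[ℝ] Sym[ℝ]^2 W} (hx : x ∈ (psdCone V).minTensorProduct (psdCone W)) :
    (tensorMat b c x).PosSemidef := by
  refine minTensorProduct_psdCone_induction (p := fun x => (tensorMat b c x).PosSemidef)
    (fun v w => ?_) ?_ (fun x y hx hy => ?_) (fun a x ha hx => ?_) hx
  · rw [tensorMat_sq]; exact posSemidef_vecMulVec _
  · rw [map_zero]; exact Matrix.PosSemidef.zero
  · rw [map_add]; exact hx.add hy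
  · rw [map_smul]; exact hx.smul ha

theorem mem_minTensorProduct_of_sepCone (b : Basis ι ℝ V) (c : Basis κ ℝ W)
    {x : Sym[ℝ]^2 V ⊗[ℝ] Sym[ℝ]^2 W} (hx : tensorMat b c x ∈ sepCone ι κ) :
    x ∈ (psdCone V).minTensorProduct (psdCone W) := by
  suffices h : ∀ σ ∈ sepCone ι κ, ∃ y ∈ (psdCone V).minTensorProduct (psdCone W),
      tensorMat b c y = σ by
    obtain ⟨y, hy, hxy⟩ := h _ hx
    rwa [← tensorMat_injective b c hxy]
  intro σ hσ
  induction hσ using Submodule.span_induction with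
  | mem σ h =>
    obtain ⟨v, w, rfl⟩ := h
    refine ⟨_, sq_tmul_sq_mem (b.equivFun.symm v) (c.equivFun.symm w), ?_⟩
    rw [tensorMat_sq, ← Basis.equivFun_apply, ← Basis.equivFun_apply,
      LinearEquiv.apply_symm_apply, LinearEquiv.apply_symm_apply]
  | zero => exact ⟨0, Submodule.zero_mem _, map_zero _⟩
  | add σ τ _ _ hσ hτ =>
    obtain ⟨x, hx, rfl⟩ := hσ
    obtain ⟨y, hy, rfl⟩ := hτ
    exact ⟨x + y, Submodule.add_mem _ hx hy, map_add _ _ _⟩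
  | smul a σ _ hσ =>
    obtain ⟨x, hx, rfl⟩ := hσ
    exact ⟨a • x, Submodule.smul_mem _ a hx, (tensorMat b c).map_smul (a : ℝ) x⟩

theorem mem_minTensorProduct_iff {m n : ℕ} (hmn : min m n ≤ 2) (b : Basis (Fin m) ℝ V)
    (c : Basis (Fin n) ℝ W) (x : Sym[ℝ]^2 V ⊗[ℝ] Sym[ℝ]^2 W) :
    x ∈ (psdCone V).minTensorProduct (psdCone W) ↔ (tensorMat b c x).PosSemidef :=
  ⟨posSemidef_tensorMat b c, fun h => mem_minTensorProduct_of_sepCone b c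
    (mem_sepCone_of_min_le_two hmn h (tensorMat_partialTranspose b c x))⟩

end TensorCone

/-! ### Positive maps and their Choi matrices. -/

section HomCone

variable {V W : Type*} [AddCommGroup V] [Module ℝ V] [AddCommGroup W] [Module ℝ W]
  {ι κ : Type*}

theorem mem_homCone_of_sq {f : Sym[ℝ]^2 V →ₗ[ℝ] Sym[ℝ]^2 W}
    (hf : ∀ v, f (symMul v v) ∈ psdCone W) : f ∈ homCone (psdCone V) (psdCone W) := by
  intro x hx
  induction hx using Submodule.span_induction with
  | mem x h =>
    obtain ⟨v, rfl⟩ := h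
    simp only [tprod_eq_symMul]
    exact hf v
  | zero => rw [map_zero]; exact Submodule.zero_mem _
  | add x y _ _ hx hy => rw [map_add]; exact Submodule.add_mem _ hx hy
  | smul a x _ hx =>
    have : f (a • x) = (a : ℝ) • f x := f.map_smul (a : ℝ) x
    rw [this]
    exact Submodule.smul_mem _ a hx

/-- The elementary linear maps from `Sym² V` to `Sym² W`. -/
def elemHom (b : Basis ι ℝ V) (c : Basis κ ℝ W) (p q : ι × κ) :
    Sym[ℝ]^2 V →ₗ[ℝ] Sym[ℝ]^2 W :=
  (Matrix.entryLinearMap ℝ ℝ p.1 q.1 ∘ₗ symMat b).smulRight (symMul (c p.2) (c q.2))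

theorem elemHom_apply (b : Basis ι ℝ V) (c : Basis κ ℝ W) (p q : ι × κ) (x : Sym[ℝ]^2 V) :
    elemHom b c p q x = symMat b x p.1 q.1 • symMul (c p.2) (c q.2) := rfl

theorem elemHom_comm (b : Basis ι ℝ V) (c : Basis κ ℝ W) (p q : ι × κ) :
    elemHom b c p q = elemHom b c q p := by
  ext x
  have h := congrFun (congrFun (symMat_transpose b x) p.1) q.1
  rw [Matrix.transpose_apply] at h
  rw [elemHom_apply, elemHom_apply, h, symMul_comm]

/-- Hence every functional on linear maps yields a matrix invariant under partial transposition. -/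
theorem elemHom_partialTranspose (b : Basis ι ℝ V) (c : Basis κ ℝ W) (i j : ι) (k l : κ) :
    elemHom b c (i, k) (j, l) = elemHom b c (j, k) (i, l) := by
  ext x
  have h := congrFun (congrFun (symMat_transpose b x) i) j
  rw [Matrix.transpose_apply] at h
  rw [elemHom_apply, elemHom_apply, h]

/-- The Choi matrix of a linear map from `Sym² V` to `Sym² W`. -/
def choiMat (b : Basis ι ℝ V) (c : Basis κ ℝ W) (f : Sym[ℝ]^2 V →ₗ[ℝ] Sym[ℝ]^2 W) :
    Matrix (ι × κ) (ι × κ) ℝ :=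
  Matrix.of fun p q => symMat c (f (symMul (b p.1) (b q.1))) p.2 q.2

theorem choiMat_isSymm (b : Basis ι ℝ V) (c : Basis κ ℝ W)
    (f : Sym[ℝ]^2 V →ₗ[ℝ] Sym[ℝ]^2 W) : (choiMat b c f).IsSymm := by
  ext p q
  have h := congrFun (congrFun (symMat_transpose c (f (symMul (b p.1) (b q.1)))) p.2) q.2
  rw [Matrix.transpose_apply] at h
  simp only [choiMat, Matrix.transpose_apply, Matrix.of_apply]
  rw [symMul_comm, h]

variable [Fintype ι] [Fintype κ]

/-- The linear map from `Sym² V` to `Sym² W` with a given Choi matrix. -/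
def choiHom (b : Basis ι ℝ V) (c : Basis κ ℝ W) :
    Matrix (ι × κ) (ι × κ) ℝ →ₗ[ℝ] (Sym[ℝ]^2 V →ₗ[ℝ] Sym[ℝ]^2 W) :=
  ∑ p, ∑ q, (Matrix.entryLinearMap ℝ ℝ p q).smulRight (elemHom b c p q)

theorem choiHom_apply (b : Basis ι ℝ V) (c : Basis κ ℝ W) (Q : Matrix (ι × κ) (ι × κ) ℝ) :
    choiHom b c Q = ∑ p, ∑ q, Q p q • elemHom b c p q := by
  simp [choiHom]

/-- A rank-one Choi matrix acts as `v² ↦ (L v)²` for a linear `L : V → W`, so it preserves sums of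
squares. -/
theorem choiHom_vecMulVec_sq (b : Basis ι ℝ V) (c : Basis κ ℝ W) (u : ι × κ → ℝ) (v : V) :
    choiHom b c (Matrix.vecMulVec u u) (symMul v v) =
      symMul (∑ p, (u p * b.repr v p.1) • c p.2) (∑ p, (u p * b.repr v p.1) • c p.2) := by
  simp only [choiHom_apply, LinearMap.sum_apply, LinearMap.smul_apply, elemHom_apply,
    symMat_symMul_self, Matrix.vecMulVec_apply, map_sum, map_smul, Finset.smul_sum, smul_smul]
  rw [Finset.sum_comm]
  refine Finset.sum_congr rfl fun p _ => Finset.sum_congr rfl fun q _ => ?_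
  congr 1
  ring

theorem choiHom_mem_homCone (b : Basis ι ℝ V) (c : Basis κ ℝ W) {Q : Matrix (ι × κ) (ι × κ) ℝ}
    (hQ : Q.PosSemidef) : choiHom b c Q ∈ homCone (psdCone V) (psdCone W) := by
  obtain ⟨u, rfl⟩ := exists_eq_sum_vecMulVec hQ
  refine mem_homCone_of_sq fun v => ?_
  rw [map_sum, LinearMap.sum_apply]
  refine Submodule.sum_mem _ fun k _ => ?_
  rw [choiHom_vecMulVec_sq]
  exact symMul_self_mem_psdCone _

/-- `choiMat` is only a section of `choiHom`. It need not be positive semidefinite for a positive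
map, even when another preimage is; hence a projection is used. -/
theorem choiHom_choiMat (b : Basis ι ℝ V) (c : Basis κ ℝ W)
    (f : Sym[ℝ]^2 V →ₗ[ℝ] Sym[ℝ]^2 W) : choiHom b c (choiMat b c f) = f := by
  ext x
  have h : f x = ∑ i, ∑ j, symMat b x i j • matSym c (symMat c (f (symMul (b i) (b j)))) := by
    conv_lhs => rw [← matSym_symMat b x, matSym_apply]
    simp only [map_sum, map_smul, matSym_symMat]
  rw [h]
  simp only [choiHom_apply, LinearMap.sum_apply, LinearMap.smul_apply, elemHom_apply,
    Fintype.sum_prod_type, choiMat, Matrix.of_apply, matSym_apply, Finset.smul_sum, smul_smul]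
  refine Finset.sum_congr rfl fun i _ => ?_
  rw [Finset.sum_comm]
  refine Finset.sum_congr rfl fun j _ => Finset.sum_congr rfl fun k _ =>
    Finset.sum_congr rfl fun l _ => ?_
  rw [mul_comm]

/-- The functional on linear maps that corresponds to the trace of the Choi matrix. -/
def choiTrace (b : Basis ι ℝ V) (c : Basis κ ℝ W) : Dual ℝ (Sym[ℝ]^2 V →ₗ[ℝ] Sym[ℝ]^2 W) :=
  ∑ i, Matrix.traceLinearMap κ ℝ ℝ ∘ₗ symMat c ∘ₗ LinearMap.applyₗ (symMul (b i) (b i))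

/-- The trace descends through `choiHom`, which is the input for closedness of the image cone. -/
theorem choiTrace_choiHom (b : Basis ι ℝ V) (c : Basis κ ℝ W) (Q : Matrix (ι × κ) (ι × κ) ℝ) :
    choiTrace b c (choiHom b c Q) = Q.trace := by
  classical
  have h1 (p q : ι × κ) : choiTrace b c (elemHom b c p q) = if p = q then 1 else 0 := by
    have ht : (symMat c (symMul (c p.2) (c q.2))).trace = if p.2 = q.2 then 1 else 0 := by
      simp only [Matrix.trace, Matrix.diag_apply, symMat_symMul, Basis.repr_self,
        Finsupp.single_apply]
      rw [Finset.sum_eq_single p.2]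
      · simp [eq_comm]; split_ifs <;> norm_num
      · intro k _ hk; simp [hk.symm]
      · simp
    simp only [choiTrace, LinearMap.sum_apply, LinearMap.comp_apply, LinearMap.applyₗ_apply_apply,
      elemHom_apply, map_smul, Matrix.traceLinearMap_apply, ht, symMat_symMul_self,
      Matrix.vecMulVec_apply, Basis.repr_self, Finsupp.single_apply, Prod.ext_iff]
    rw [Finset.sum_eq_single p.1]
    · by_cases h : p.1 = q.1 <;> simp [h]
    · intro i _ hi; simp [hi]
    · simp
  simp [choiHom_apply, h1, Matrix.trace]

/-- On the square of `v ⊗ w` the pairing is the value at `w` of the positive semidefinite form of `f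
(v²)`. -/
theorem sum_mul_choiMat_nonneg (b : Basis ι ℝ V) (c : Basis κ ℝ W)
    {f : Sym[ℝ]^2 V →ₗ[ℝ] Sym[ℝ]^2 W} (hf : f ∈ homCone (psdCone V) (psdCone W))
    {σ : Matrix (ι × κ) (ι × κ) ℝ} (hσ : σ ∈ sepCone ι κ) :
    0 ≤ ∑ p, ∑ q, σ p q * choiMat b c f p q := by
  induction hσ using Submodule.span_induction with
  | mem σ h =>
    obtain ⟨v, w, rfl⟩ := h
    have h1 := hf _ (symMul_self_mem_psdCone (b.equivFun.symm v))
    rw [mem_psdCone_iff c] at h1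
    have h2 := h1.dotProduct_mulVec_nonneg w
    refine h2.trans_eq (Eq.symm ?_)
    rw [symMul_eq_sum b]
    have hv : ⇑(b.repr (b.equivFun.symm v)) = v := by
      rw [← Basis.equivFun_apply, LinearEquiv.apply_symm_apply]
    simp only [hv, map_sum, map_smul, dotProduct, Matrix.mulVec, Matrix.sum_apply,
      Matrix.smul_apply, smul_eq_mul, star_trivial, Fintype.sum_prod_type, Matrix.vecMulVec_apply,
      prodVec, choiMat, Matrix.of_apply, Finset.mul_sum, Finset.sum_mul]
    rw [Finset.sum_comm]
    refine Finset.sum_congr rfl fun k _ => ?_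
    calc _ = ∑ i, ∑ l, ∑ j, v i * w k * (v j * w l) *
          symMat c (f (symMul (b i) (b j))) k l :=
          Finset.sum_congr rfl fun i _ => Finset.sum_comm
      _ = ∑ l, ∑ i, ∑ j, v i * w k * (v j * w l) *
          symMat c (f (symMul (b i) (b j))) k l := Finset.sum_comm
      _ = _ := Finset.sum_congr rfl fun l _ => Finset.sum_congr rfl fun i _ =>
          Finset.sum_congr rfl fun j _ => by ring
  | zero => simp
  | add σ τ _ _ hσ hτ =>
    simp only [Matrix.add_apply, add_mul, Finset.sum_add_distrib]
    exact add_nonneg hσ hτ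
  | smul a σ _ hσ =>
    have h : ∑ p, ∑ q, (a • σ) p q * choiMat b c f p q =
        (a : ℝ) * ∑ p, ∑ q, σ p q * choiMat b c f p q := by
      simp only [Finset.mul_sum, ← mul_assoc]
      rfl
    rw [h]
    exact mul_nonneg a.2 hσ

/-- The linear map from `Sym² (ℝ^(ι × κ))` whose image of the positive semidefinite cone is the
cone of completely positive maps. -/
def choiSym (b : Basis ι ℝ V) (c : Basis κ ℝ W) :
    Sym[ℝ]^2 (ι × κ → ℝ) →ₗ[ℝ] (Sym[ℝ]^2 V →ₗ[ℝ] Sym[ℝ]^2 W) :=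
  choiHom b c ∘ₗ symMat (Pi.basisFun ℝ (ι × κ))

theorem choiSym_surjective (b : Basis ι ℝ V) (c : Basis κ ℝ W) :
    Function.Surjective (choiSym b c) := by
  classical
  intro f
  refine ⟨matSym (Pi.basisFun ℝ (ι × κ)) (choiMat b c f), ?_⟩
  rw [choiSym, LinearMap.comp_apply, symMat_matSym _ (choiMat_isSymm b c f), choiHom_choiMat]

theorem span_psdCone : Submodule.span ℝ (psdCone V : Set (Sym[ℝ]^2 V)) = ⊤ := by
  rw [eq_top_iff, ← span_symMul_self, Submodule.span_le]
  rintro _ ⟨v, rfl⟩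
  exact Submodule.subset_span (symMul_self_mem_psdCone v)

theorem isAlmostCompact_map_choiSym [FiniteDimensional ℝ V] [FiniteDimensional ℝ W]
    (b : Basis ι ℝ V) (c : Basis κ ℝ W) :
    IsAlmostCompact ((psdCone (ι × κ → ℝ)).map (choiSym b c)) :=
  isAlmostCompact_map (symMat (Pi.basisFun ℝ (ι × κ))) (symMat_injective _) (mem_psdCone_iff _)
    span_psdCone (choiSym b c) (choiSym_surjective b c) (choiTrace b c)
    fun _ => choiTrace_choiHom b c _

/-- If one of the spaces has dimension at most two, then every positive map is completely
positive. -/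
theorem map_choiSym_eq_homCone [FiniteDimensional ℝ V] [FiniteDimensional ℝ W]
    {m n : ℕ} (hmn : min m n ≤ 2) (b : Basis (Fin m) ℝ V) (c : Basis (Fin n) ℝ W) :
    (psdCone (Fin m × Fin n → ℝ)).map (choiSym b c) = homCone (psdCone V) (psdCone W) := by
  apply le_antisymm
  · intro f hf
    obtain ⟨x, hx, rfl⟩ := PointedCone.mem_map.1 hf
    exact choiHom_mem_homCone b c ((mem_psdCone_iff _ x).1 hx)
  · intro f hf
    by_contra hnot
    obtain ⟨l, hl, hlf⟩ := exists_dual_neg_of_notMem (isAlmostCompact_map_choiSym b c).closed hnot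
    -- The matrix of the separating functional: it is positive semidefinite by testing on rank-one
    -- Choi matrices, hence separable, and its pairing with `f` contradicts `l f < 0`.
    let ρ : Matrix (Fin m × Fin n) (Fin m × Fin n) ℝ := Matrix.of fun p q => l (elemHom b c p q)
    have hlQ (Q : Matrix (Fin m × Fin n) (Fin m × Fin n) ℝ) :
        l (choiHom b c Q) = ∑ p, ∑ q, ρ p q * Q p q := by
      simp only [choiHom_apply, map_sum, map_smul, smul_eq_mul, ρ, Matrix.of_apply, mul_comm]
    have hρ : ρ.PosSemidef := by
      refine Matrix.PosSemidef.of_dotProduct_mulVec_nonneg ?_ fun u => ?_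
      · ext p q
        simp only [Matrix.conjTranspose_apply, star_trivial, ρ, Matrix.of_apply]
        rw [elemHom_comm]
      · have h := hl (choiHom b c (Matrix.vecMulVec u u)) (PointedCone.mem_map.2
          ⟨matSym (Pi.basisFun ℝ _) (Matrix.vecMulVec u u), ?_, ?_⟩)
        · rw [hlQ] at h
          refine h.trans_eq (Eq.symm ?_)
          simp only [dotProduct, Matrix.mulVec, star_trivial, Finset.mul_sum,
            Matrix.vecMulVec_apply]
          exact Finset.sum_congr rfl fun p _ => Finset.sum_congr rfl fun q _ => by ring
        · rw [mem_psdCone_iff (Pi.basisFun ℝ _),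
            symMat_matSym _ (isSymm_of_posSemidef (posSemidef_vecMulVec u))]
          exact posSemidef_vecMulVec u
        · rw [choiSym, LinearMap.comp_apply,
            symMat_matSym _ (isSymm_of_posSemidef (posSemidef_vecMulVec u))]
    have hsep := mem_sepCone_of_min_le_two hmn hρ fun i j k l' => by
      simp only [ρ, Matrix.of_apply]
      rw [elemHom_partialTranspose]
    have h := sum_mul_choiMat_nonneg b c hf hsep
    rw [← hlQ, choiHom_choiMat] at h
    exact absurd hlf (not_lt.2 h)

end HomCone

/-! ### The symmetric square of a cone as an image of its tensor square. -/

section SymCone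

variable {V : Type*} [AddCommGroup V] [Module ℝ V]

/-- The linear map from the tensor square to the symmetric square. -/
def tensorToSym : V ⊗[ℝ] V →ₗ[ℝ] Sym[ℝ]^2 V := TensorProduct.lift symMul

@[simp]
theorem tensorToSym_tmul (x y : V) : tensorToSym (x ⊗ₜ y) = symMul x y := by
  simp [tensorToSym]

theorem tensorToSym_surjective : Function.Surjective (tensorToSym (V := V)) := by
  rw [← LinearMap.range_eq_top, eq_top_iff, ← span_symMul, Submodule.span_le]
  rintro _ ⟨x, y, rfl⟩
  exact ⟨x ⊗ₜ y, by simp⟩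

theorem map_tensorToSym (C : PointedCone ℝ V) :
    (C.minTensorProduct C).map tensorToSym = symPower 2 C := by
  rw [PointedCone.minTensorProduct, symPower, PointedCone.map, PointedCone.hull,
    Submodule.map_span]
  congr 1
  ext s
  constructor
  · rintro ⟨_, ⟨x, hx, y, hy, rfl⟩, rfl⟩
    refine ⟨![x, y], ?_, ?_⟩
    · intro i; fin_cases i <;> assumption
    · rw [tprod_eq_symMul]
      exact tensorToSym_tmul x y
  · rintro ⟨v, hv, rfl⟩
    refine ⟨v 0 ⊗ₜ v 1, ⟨_, hv 0, _, hv 1, rfl⟩, ?_⟩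
    rw [tprod_eq_symMul]
    exact tensorToSym_tmul _ _

/-- The functional on `Sym² (Sym² V)` induced by the product of traces. -/
def traceSq {ι : Type*} [Fintype ι] (b : Basis ι ℝ V) : Dual ℝ (Sym[ℝ]^2 (Sym[ℝ]^2 V)) :=
  symLift (LinearMap.mk₂ ℝ (fun x y => (symMat b x).trace * (symMat b y).trace)
    (fun x x' y => by simp; ring) (fun c x y => by simp; ring)
    (fun x y y' => by simp; ring) (fun c x y => by simp; ring))
    (fun x y => by simp [mul_comm])

/-- The trace of the tensor matrix is a symmetric product of traces, so it factors through the
symmetric square. -/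
theorem traceSq_tensorToSym {ι : Type*} [Fintype ι] (b : Basis ι ℝ V)
    (x : Sym[ℝ]^2 V ⊗[ℝ] Sym[ℝ]^2 V) :
    traceSq b (tensorToSym x) = (tensorMat b b x).trace := by
  induction x using TensorProduct.induction_on with
  | zero => simp
  | tmul x y =>
    simp only [tensorToSym_tmul, traceSq, symLift_symMul, LinearMap.mk₂_apply, Matrix.trace,
      Matrix.diag_apply, tensorMat_tmul, Fintype.sum_prod_type, Finset.sum_mul_sum]
  | add x y hx hy => simp [hx, hy]

end SymCone

/-! ### The positive results in dimension at most two. -/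

section LowDimension

variable {V W : Type*} [AddCommGroup V] [Module ℝ V] [FiniteDimensional ℝ V]
  [AddCommGroup W] [Module ℝ W] [FiniteDimensional ℝ W]

theorem isSpectrahedralCone_minTensorProduct (h : min (finrank ℝ V) (finrank ℝ W) ≤ 2) :
    IsSpectrahedralCone ((psdCone V).minTensorProduct (psdCone W)) :=
  isSpectrahedralCone_of_matrix (tensorMat (finBasis ℝ V) (finBasis ℝ W)) (tensorMat_injective _ _)
    (tensorMat_isSymm _ _) (mem_minTensorProduct_iff h _ _) span_minTensorProduct_psdCone

theorem isSpectrahedron_minTensorProduct (h : min (finrank ℝ V) (finrank ℝ W) ≤ 2) :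
    IsSpectrahedron
      ((psdCone V).minTensorProduct (psdCone W) : Set (Sym[ℝ]^2 V ⊗[ℝ] Sym[ℝ]^2 W)) :=
  isSpectrahedron_of_matrix (tensorMat (finBasis ℝ V) (finBasis ℝ W))
    (tensorMat_isSymm _ _) (mem_minTensorProduct_iff h _ _)

theorem isSDRCone_homCone (h : min (finrank ℝ V) (finrank ℝ W) ≤ 2) :
    IsSDRCone (homCone (psdCone V) (psdCone W)) := by
  have hmap := map_choiSym_eq_homCone h (finBasis ℝ V) (finBasis ℝ W)
  refine isSDRCone_of_image ?_ (symMat (Pi.basisFun ℝ _)) (symMat_injective _) (symMat_transpose _)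
    (mem_psdCone_iff _) span_psdCone _ hmap
  rw [← hmap]
  exact isAlmostCompact_map_choiSym _ _

theorem isSDRSet_homCone (h : min (finrank ℝ V) (finrank ℝ W) ≤ 2) :
    IsSDRSet (homCone (psdCone V) (psdCone W) : Set (Sym[ℝ]^2 V →ₗ[ℝ] Sym[ℝ]^2 W)) := by
  refine isSDRSet_of_image (symMat (Pi.basisFun ℝ _)) (symMat_transpose _)
    (choiSym (finBasis ℝ V) (finBasis ℝ W)) fun f => ?_
  rw [← map_choiSym_eq_homCone h (finBasis ℝ V) (finBasis ℝ W)]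
  simp only [SetLike.mem_coe, PointedCone.mem_map, mem_psdCone_iff (Pi.basisFun ℝ _)]

theorem isSDRCone_symPower (h : finrank ℝ V ≤ 2) : IsSDRCone (symPower 2 (psdCone V)) := by
  have h' : min (finrank ℝ V) (finrank ℝ V) ≤ 2 := by simpa using h
  let b := finBasis ℝ V
  refine isSDRCone_of_image ?_ (tensorMat b b) (tensorMat_injective _ _) (tensorMat_isSymm _ _)
    (mem_minTensorProduct_iff h' _ _) span_minTensorProduct_psdCone _ (map_tensorToSym (psdCone V))
  rw [← map_tensorToSym]
  exact isAlmostCompact_map (tensorMat b b) (tensorMat_injective _ _)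
    (mem_minTensorProduct_iff h' _ _) span_minTensorProduct_psdCone tensorToSym
    tensorToSym_surjective (traceSq b) (traceSq_tensorToSym b)

theorem isSDRSet_symPower (h : finrank ℝ V ≤ 2) :
    IsSDRSet (symPower 2 (psdCone V) : Set (Sym[ℝ]^2 (Sym[ℝ]^2 V))) := by
  have h' : min (finrank ℝ V) (finrank ℝ V) ≤ 2 := by simpa using h
  let b := finBasis ℝ V
  refine isSDRSet_of_image (tensorMat b b) (tensorMat_isSymm _ _) tensorToSym fun y => ?_
  rw [← map_tensorToSym]
  simp only [SetLike.mem_coe, PointedCone.mem_map, mem_minTensorProduct_iff h' b b]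

end LowDimension

/-! ### Minimal faces and the obstruction to exposedness. -/

section Facial

variable {E : Type*} [AddCommGroup E] [Module ℝ E]

/-- The smallest face of a cone that contains the point `z` of the cone. -/
def minimalFace (C : PointedCone ℝ E) (z : E) (hz : z ∈ C) : PointedCone ℝ E where
  carrier := {c | c ∈ C ∧ ∃ t : ℝ, 0 < t ∧ z - t • c ∈ C}
  zero_mem' := ⟨C.zero_mem, 1, one_pos, by simpa using hz⟩
  add_mem' := by
    rintro x y ⟨hx, t, ht, hxt⟩ ⟨hy, s, hs, hys⟩
    -- This value makes the difference a convex combination of `z - t x` and `z - s y`.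
    refine ⟨C.add_mem hx hy, t * s / (t + s), by positivity, ?_⟩
    have h : z - (t * s / (t + s)) • (x + y) =
        (s / (t + s)) • (z - t • x) + (t / (t + s)) • (z - s • y) := by
      have h1 : s / (t + s) + t / (t + s) = 1 := by field_simp; ring
      have h2 : s / (t + s) * t = t * s / (t + s) := by ring
      have h3 : t / (t + s) * s = t * s / (t + s) := by ring
      rw [smul_sub, smul_sub, smul_smul, smul_smul, h2, h3]
      nth_rewrite 1 [← one_smul ℝ z]
      rw [← h1]
      module
    rw [h]
    exact C.add_mem (C.smul_mem (r := s / (t + s)) (by positivity) hxt)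
      (C.smul_mem (r := t / (t + s)) (by positivity) hys)
  smul_mem' := by
    rintro ⟨a, ha⟩ x ⟨hx, t, ht, hxt⟩
    refine ⟨C.smul_mem ha hx, ?_⟩
    change ∃ t : ℝ, 0 < t ∧ z - t • (a • x) ∈ C
    rcases ha.eq_or_lt with rfl | ha
    · exact ⟨1, one_pos, by simpa using hz⟩
    · refine ⟨t / a, by positivity, ?_⟩
      rwa [smul_smul, div_mul_cancel₀ _ ha.ne']

theorem isFaceOf_minimalFace (C : PointedCone ℝ E) (z : E) (hz : z ∈ C) :
    (minimalFace C z hz).IsFaceOf C where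
  le := fun _ hx => hx.1
  mem_of_smul_add_mem := by
    rintro x y a hx hy ha ⟨-, t, ht, h⟩
    refine ⟨hx, t * a, by positivity, ?_⟩
    have : z - (t * a) • x = (z - t • (a • x + y)) + t • y := by module
    rw [this]
    exact C.add_mem h (C.smul_mem ht.le hy)

/-- An exposing functional vanishes at `z`, hence at `q`, which would put `q` in the minimal face.
-/
theorem not_isExposedFace_minimalFace {C : PointedCone ℝ E} {z q : E} (hz : z ∈ C) (hq : q ∈ C)
    (hzq : ∀ φ : Dual ℝ E, (∀ c ∈ C, 0 ≤ φ c) → φ z = 0 → φ q = 0)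
    (hsub : ∀ t : ℝ, 0 < t → z - t • q ∉ C) : ¬ IsExposedFace (minimalFace C z hz) C := by
  rintro ⟨φ, hφ, hF⟩
  have hzF : z ∈ (minimalFace C z hz : Set E) := ⟨hz, 1, one_pos, by simp⟩
  rw [hF] at hzF
  have hqF : q ∈ (minimalFace C z hz : Set E) := by
    rw [hF]
    exact ⟨hq, hzq φ hφ hzF.2⟩
  obtain ⟨-, t, ht, h⟩ := hqF
  exact hsub t ht h

/-- A positive semidefinite matrix dominates a small multiple of every symmetric matrix whose
kernel is larger. -/
theorem exists_posSemidef_sub_smul {ι : Type*} [Fintype ι] {M N : Matrix ι ι ℝ}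
    (hM : M.PosSemidef) (hN : N.IsSymm) (hker : ∀ u : ι → ℝ, M.mulVec u = 0 → N.mulVec u = 0) :
    ∃ t : ℝ, 0 < t ∧ (M - t • N).PosSemidef := by
  classical
  obtain ⟨R, T, hR, hT, hRR, hRT, hRTR, hTRT⟩ := exists_sqrt_pseudoinverse hM
  have hNP : N * (R * T) = N := by
    have h0 : M * (1 - R * T) = 0 := by
      rw [mul_sub, mul_one, ← hRR, sub_eq_zero, Matrix.mul_assoc R R, hRT, ← Matrix.mul_assoc R T,
        hRTR]
    have h1 : N * (1 - R * T) = 0 := by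
      ext i j
      have hz : M.mulVec ((1 - R * T).col j) = 0 := by
        ext k
        simpa [Matrix.mul_apply, Matrix.mulVec, dotProduct] using congrFun (congrFun h0 k) j
      have := congrFun (hker _ hz) i
      simpa [Matrix.mul_apply, Matrix.mulVec, dotProduct] using this
    rw [mul_sub, mul_one, sub_eq_zero] at h1
    exact h1.symm
  have hPN : (T * R) * N = N := by
    have := congrArg Matrix.transpose hNP
    rwa [Matrix.transpose_mul, Matrix.transpose_mul, hR, hT, hN.eq] at this
  have hX : (T * N * T).IsSymm := by
    rw [Matrix.IsSymm, Matrix.transpose_mul, Matrix.transpose_mul, hT, hN.eq, Matrix.mul_assoc]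
  obtain ⟨U, d, hU, hU', hXU⟩ := exists_orthogonal_diagonalization hX
  have hN' : N = R * (U * Matrix.diagonal d * U.transpose) * R := by
    rw [← hXU]
    calc N = (R * T) * N * (T * R) := by rw [hRT, hPN, ← hRT, hNP]
      _ = _ := by simp only [Matrix.mul_assoc]
  have hpos : 0 < 1 + ∑ i, |d i| := by positivity
  -- With `M = R²` and `N = R X R`, the difference is `R (1 - t X) R`; this `t` keeps `t d i` at
  -- most one for all eigenvalues `d i` of `X`.
  refine ⟨(1 + ∑ i, |d i|)⁻¹, by positivity, ?_⟩
  set t := (1 + ∑ i, |d i|)⁻¹ with ht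
  have key : M - t • N = (U.transpose * R).conjTranspose *
      Matrix.diagonal (fun i => 1 - t * d i) * (U.transpose * R) := by
    have hd : Matrix.diagonal (fun i => 1 - t * d i) = 1 - t • Matrix.diagonal d := by
      rw [← Matrix.diagonal_one, ← Matrix.diagonal_smul, Matrix.diagonal_sub]
      rfl
    rw [hd, Matrix.conjTranspose_eq_transpose_of_trivial, Matrix.transpose_mul, hR,
      Matrix.transpose_transpose, mul_sub, sub_mul, mul_one]
    congr 1
    · calc M = R * (U * U.transpose) * R := by rw [hU', mul_one, hRR]
        _ = _ := by simp only [Matrix.mul_assoc]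
    · rw [Matrix.mul_smul, Matrix.smul_mul]
      congr 1
      rw [hN']
      simp only [Matrix.mul_assoc]
  rw [key]
  refine Matrix.PosSemidef.conjTranspose_mul_mul_same (Matrix.PosSemidef.diagonal fun i => ?_) _
  have h1 : d i ≤ ∑ i, |d i| := (le_abs_self _).trans
    (Finset.single_le_sum (f := fun i => |d i|) (fun i _ => abs_nonneg _) (Finset.mem_univ i))
  have h2 : t * (1 + ∑ i, |d i|) = 1 := inv_mul_cancel₀ hpos.ne'
  have ht0 : 0 < t := by positivity
  simp only [Pi.zero_apply, sub_nonneg]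
  nlinarith

/-- Each kernel vector `u` of the matrix at `z` gives the functional `uᵀ B(x) u`, nonnegative on `C`
and zero at `z`, hence zero at `q`. So `B q` vanishes on that kernel, and a small multiple of `q`
can be subtracted. -/
theorem not_isSpectrahedron_of_sub_notMem {C : PointedCone ℝ E} {z q : E} (hz : z ∈ C) (hq : q ∈ C)
    (hzq : ∀ φ : Dual ℝ E, (∀ c ∈ C, 0 ≤ φ c) → φ z = 0 → φ q = 0)
    (hsub : ∀ t : ℝ, 0 < t → z - t • q ∉ C) : ¬ IsSpectrahedron (C : Set E) := by
  rintro ⟨k, A, B, hA, hB, hC⟩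
  have hC' (x : E) : x ∈ C ↔ (A + B x).PosSemidef := Set.ext_iff.1 hC x
  have hA0 : A.PosSemidef := by simpa using (hC' 0).1 C.zero_mem
  have hker (u : Fin k → ℝ) (hu : (A + B z).mulVec u = 0) : (B q).mulVec u = 0 := by
    let φ : Dual ℝ E :=
      { toFun := fun x => u ⬝ᵥ (B x).mulVec u
        map_add' := fun x y => by simp [Matrix.add_mulVec]
        map_smul' := fun r x => by simp [Matrix.smul_mulVec] }
    have hφ (x : E) : φ x = u ⬝ᵥ (B x).mulVec u := rfl
    have hAu : 0 ≤ u ⬝ᵥ A.mulVec u := by simpa using hA0.dotProduct_mulVec_nonneg u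
    have hφC (c : E) (hc : c ∈ C) : 0 ≤ φ c := by
      by_contra! hneg
      -- Scaling `c` by a large `r` would overwhelm the constant term `uᵀ A u`.
      obtain ⟨r, hr⟩ := exists_nat_gt ((u ⬝ᵥ A.mulVec u) / (-φ c))
      have h := ((hC' ((r : ℝ) • c)).1 (C.smul_mem (Nat.cast_nonneg r) hc)).dotProduct_mulVec_nonneg
        u
      rw [star_trivial, Matrix.add_mulVec, dotProduct_add, ← hφ, map_smul, smul_eq_mul] at h
      rw [div_lt_iff₀ (by linarith)] at hr
      linarith
    have h0 : u ⬝ᵥ A.mulVec u + φ z = 0 := by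
      rw [hφ, ← dotProduct_add, ← Matrix.add_mulVec, hu, dotProduct_zero]
    have hφz : φ z = 0 := le_antisymm (by linarith) (hφC z hz)
    have hφq := hzq φ hφC hφz
    have h1 : A.mulVec u = 0 := by
      rw [← hA0.dotProduct_mulVec_zero_iff, star_trivial]
      linarith
    have h2 : (A + B q).mulVec u = 0 := by
      rw [← ((hC' q).1 hq).dotProduct_mulVec_zero_iff, star_trivial, Matrix.add_mulVec,
        dotProduct_add, ← hφ, hφq, h1]
      simp
    rwa [Matrix.add_mulVec, h1, zero_add] at h2
  obtain ⟨t, ht, h⟩ := exists_posSemidef_sub_smul ((hC' z).1 hz) (hB q) hker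
  refine hsub t ht ((hC' _).2 ?_)
  rwa [map_sub, map_smul, ← add_sub_assoc]

end Facial

/-! ### A nonnegative biquadratic form and its zeros. -/

section BiquadraticForm

/-- A nonnegative biquadratic form with ten zeros, of the family of Cho, Kye and Lee. -/
def ckl (x y : Fin 3 → ℝ) : ℝ :=
  9 * (x 0 ^ 2 * y 0 ^ 2 + x 1 ^ 2 * y 1 ^ 2 + x 2 ^ 2 * y 2 ^ 2) +
  16 * (x 0 ^ 2 * y 1 ^ 2 + x 1 ^ 2 * y 2 ^ 2 + x 2 ^ 2 * y 0 ^ 2) +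
  (x 0 ^ 2 * y 2 ^ 2 + x 1 ^ 2 * y 0 ^ 2 + x 2 ^ 2 * y 1 ^ 2) -
  26 * (x 0 * x 1 * y 0 * y 1 + x 1 * x 2 * y 1 * y 2 + x 2 * x 0 * y 2 * y 0)

/-- A biquadratic form that vanishes at all zeros of `ckl` but one. -/
def cklSep (x y : Fin 3 → ℝ) : ℝ :=
  3 * (x 0 * x 1 * y 1 * y 2 + x 1 * x 2 * y 2 * y 0 + x 2 * x 0 * y 0 * y 1) +
  2 * (x 0 * x 1 * y 0 * y 1 + x 1 * x 2 * y 1 * y 2 + x 2 * x 0 * y 2 * y 0) -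
  (x 0 ^ 2 * y 0 ^ 2 + x 1 ^ 2 * y 1 ^ 2 + x 2 ^ 2 * y 2 ^ 2)

/-- Here `x` is a scaled sign vector and `y` is parallel to it; only equal signs, the tenth zero,
give a nonzero value. -/
theorem cklSep_nonneg_of_sq_eq {x y : Fin 3 → ℝ} (hx2 : x 2 ≠ 0) (e0 : x 0 ^ 2 = x 2 ^ 2)
    (e1 : x 1 ^ 2 = x 2 ^ 2) (w0 : y 0 * x 1 = y 1 * x 0) (w1 : y 0 * x 2 = y 2 * x 0) :
    0 ≤ cklSep x y := by
  rcases sq_eq_sq_iff_eq_or_eq_neg.1 e0 with s0 | s0 <;>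
  rcases sq_eq_sq_iff_eq_or_eq_neg.1 e1 with s1 | s1 <;>
  rw [s0] at w0 w1 <;> rw [s1] at w0
  · have r0 : y 0 = y 2 := mul_right_cancel₀ hx2 w1
    have r1 : y 1 = y 2 := by rw [← r0]; exact (mul_right_cancel₀ hx2 w0).symm
    have h : cklSep x y = 12 * (x 2 * y 2) ^ 2 := by
      simp only [cklSep, s0, s1, r0, r1]; ring
    rw [h]
    positivity
  · have r0 : y 0 = y 2 := mul_right_cancel₀ hx2 w1
    have r1 : y 1 = -y 2 := mul_right_cancel₀ hx2 (by rw [← r0]; linarith)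
    apply le_of_eq
    simp only [cklSep, s0, s1, r0, r1]
    ring
  · have r0 : y 0 = -y 2 := mul_right_cancel₀ hx2 (by linarith)
    have r1 : y 1 = y 2 := mul_right_cancel₀ hx2 (by rw [r0] at w0; linarith)
    apply le_of_eq
    simp only [cklSep, s0, s1, r0, r1]
    ring
  · have r0 : y 0 = -y 2 := mul_right_cancel₀ hx2 (by linarith)
    have r1 : y 1 = -y 2 := mul_right_cancel₀ hx2 (by rw [r0] at w0; linarith)
    apply le_of_eq
    simp only [cklSep, s0, s1, r0, r1]
    ring

theorem cklSep_eq_zero_of_sq_eq {x y : Fin 3 → ℝ} (hx0 : x 0 ≠ 0) (hx2 : x 2 = 0) (hy2 : y 2 = 0)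
    (e1 : x 1 ^ 2 = (2 * x 0) ^ 2) (w : y 0 * x 1 = 4 * y 1 * x 0) : cklSep x y = 0 := by
  rcases sq_eq_sq_iff_eq_or_eq_neg.1 e1 with s1 | s1
  · rw [s1] at w
    have r0 : y 0 = 2 * y 1 := mul_right_cancel₀ hx0 (by linarith)
    simp only [cklSep, s1, r0, hx2, hy2]
    ring
  · rw [s1] at w
    have r0 : y 0 = -(2 * y 1) := mul_right_cancel₀ hx0 (by linarith)
    simp only [cklSep, s1, r0, hx2, hy2]
    ring

/-- In `y` the form is diagonal, with weights `D_i`, minus `13 (x ⬝ y)²`. Weighted Cauchy–Schwarz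
reduces positivity to `P ≥ 0`, which is visible in `a` and `b` once `x 2 ^ 2` is smallest. At a zero
with `y ≠ 0`, `P = 0` and `D_i y_i` is proportional to `x_i`. -/
theorem ckl_of_min (x y : Fin 3 → ℝ) (h0 : x 2 ^ 2 ≤ x 0 ^ 2) (h1 : x 2 ^ 2 ≤ x 1 ^ 2) :
    0 ≤ ckl x y ∧ (ckl x y = 0 → 0 ≤ cklSep x y) := by
  obtain ⟨a, ha⟩ : ∃ a, x 0 ^ 2 = x 2 ^ 2 + a := ⟨_, (add_sub_cancel _ _).symm⟩
  obtain ⟨b, hb⟩ : ∃ b, x 1 ^ 2 = x 2 ^ 2 + b := ⟨_, (add_sub_cancel _ _).symm⟩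
  have ha0 : 0 ≤ a := by linarith
  have hb0 : 0 ≤ b := by linarith
  rcases eq_or_ne (x 0 ^ 2 + x 1 ^ 2) 0 with hx | hx
  · have e0 : x 0 = 0 := by nlinarith [sq_nonneg (x 0), sq_nonneg (x 1)]
    have e1 : x 1 = 0 := by nlinarith [sq_nonneg (x 0), sq_nonneg (x 1)]
    have e2 : x 2 = 0 := by
      rw [e0] at h0
      nlinarith [sq_nonneg (x 2)]
    simp [ckl, cklSep, e0, e1, e2]
  have hxpos : 0 < x 0 ^ 2 + x 1 ^ 2 := lt_of_le_of_ne (by positivity) hx.symm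
  have hc0 := sq_nonneg (x 2)
  obtain ⟨D0, hD0⟩ : ∃ d, d = 22 * x 0 ^ 2 + x 1 ^ 2 + 16 * x 2 ^ 2 := ⟨_, rfl⟩
  obtain ⟨D1, hD1⟩ : ∃ d, d = 22 * x 1 ^ 2 + x 2 ^ 2 + 16 * x 0 ^ 2 := ⟨_, rfl⟩
  obtain ⟨D2, hD2⟩ : ∃ d, d = 22 * x 2 ^ 2 + x 0 ^ 2 + 16 * x 1 ^ 2 := ⟨_, rfl⟩
  have p0 : 0 < D0 := by nlinarith [sq_nonneg (x 0), sq_nonneg (x 1)]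
  have p1 : 0 < D1 := by nlinarith [sq_nonneg (x 0), sq_nonneg (x 1)]
  have p2 : 0 < D2 := by nlinarith [sq_nonneg (x 0), sq_nonneg (x 1)]
  obtain ⟨Q, hQ⟩ : ∃ r, r = D0 * y 0 ^ 2 + D1 * y 1 ^ 2 + D2 * y 2 ^ 2 := ⟨_, rfl⟩
  obtain ⟨P, hP⟩ : ∃ r, r = 1521 * x 2 ^ 2 * (a ^ 2 - a * b + b ^ 2) +
      9 * (a + 16 * b) * (4 * a - b) ^ 2 := ⟨_, rfl⟩
  have hPeq : P = D0 * D1 * D2 -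
      13 * (x 0 ^ 2 * D1 * D2 + x 1 ^ 2 * D0 * D2 + x 2 ^ 2 * D0 * D1) := by
    rw [hP, hD0, hD1, hD2, ha, hb]
    ring
  have hab : 0 ≤ a ^ 2 - a * b + b ^ 2 := by nlinarith [sq_nonneg (a - b), mul_nonneg ha0 hb0]
  have hQ0 : 0 ≤ Q := by rw [hQ]; positivity
  have hP1 : 0 ≤ 1521 * x 2 ^ 2 * (a ^ 2 - a * b + b ^ 2) := by positivity
  have hP2 : 0 ≤ 9 * (a + 16 * b) * (4 * a - b) ^ 2 := by positivity
  have hP0 : 0 ≤ P := hP ▸ add_nonneg hP1 hP2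
  -- Lagrange's identity for the weighted Cauchy–Schwarz inequality, with denominators cleared.
  have hid : D0 * D1 * D2 * ckl x y = Q * P + 13 * (D2 * (D0 * y 0 * x 1 - D1 * y 1 * x 0) ^ 2 +
      D1 * (D0 * y 0 * x 2 - D2 * y 2 * x 0) ^ 2 + D0 * (D1 * y 1 * x 2 - D2 * y 2 * x 1) ^ 2) := by
    have hckl : ckl x y = Q - 13 * (x 0 * y 0 + x 1 * y 1 + x 2 * y 2) ^ 2 := by
      rw [hQ, hD0, hD1, hD2, ckl]
      ring
    rw [hckl, hPeq, hQ]
    ring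
  have t0 : 0 ≤ D2 * (D0 * y 0 * x 1 - D1 * y 1 * x 0) ^ 2 := by positivity
  have t1 : 0 ≤ D1 * (D0 * y 0 * x 2 - D2 * y 2 * x 0) ^ 2 := by positivity
  have t2 : 0 ≤ D0 * (D1 * y 1 * x 2 - D2 * y 2 * x 1) ^ 2 := by positivity
  have hQP : 0 ≤ Q * P := mul_nonneg hQ0 hP0
  have hD : 0 < D0 * D1 * D2 := by positivity
  refine ⟨nonneg_of_mul_nonneg_right (by rw [hid]; positivity) hD, fun hzero => ?_⟩
  rw [hzero, mul_zero] at hid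
  have z0 : D0 * y 0 * x 1 = D1 * y 1 * x 0 := by
    have : D2 * (D0 * y 0 * x 1 - D1 * y 1 * x 0) ^ 2 = 0 := by linarith
    simpa [p2.ne', sub_eq_zero] using this
  have z1 : D0 * y 0 * x 2 = D2 * y 2 * x 0 := by
    have : D1 * (D0 * y 0 * x 2 - D2 * y 2 * x 0) ^ 2 = 0 := by linarith
    simpa [p1.ne', sub_eq_zero] using this
  have zQP : Q * P = 0 := by linarith
  rcases mul_eq_zero.1 zQP with zQ | zP
  · have u0 : 0 ≤ D0 * y 0 ^ 2 := by positivity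
    have u1 : 0 ≤ D1 * y 1 ^ 2 := by positivity
    have u2 : 0 ≤ D2 * y 2 ^ 2 := by positivity
    have v0 : y 0 = 0 := by
      have : D0 * y 0 ^ 2 = 0 := by linarith
      simpa [p0.ne'] using this
    have v1 : y 1 = 0 := by
      have : D1 * y 1 ^ 2 = 0 := by linarith
      simpa [p1.ne'] using this
    have v2 : y 2 = 0 := by
      have : D2 * y 2 ^ 2 = 0 := by linarith
      simpa [p2.ne'] using this
    simp [cklSep, v0, v1, v2]
  have zP1 : 1521 * x 2 ^ 2 * (a ^ 2 - a * b + b ^ 2) = 0 := by linarith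
  have zP2 : 9 * (a + 16 * b) * (4 * a - b) ^ 2 = 0 := by linarith
  have hba : b = 4 * a := by
    rcases mul_eq_zero.1 zP2 with h | h
    · have : a = 0 := by linarith
      linarith
    · have := pow_eq_zero_iff (two_ne_zero) |>.1 h
      linarith
  rcases eq_or_ne a 0 with ha' | ha'
  · -- all coordinates of `x` have the same absolute value
    have e0 : x 0 ^ 2 = x 2 ^ 2 := by linarith
    have e1 : x 1 ^ 2 = x 2 ^ 2 := by linarith
    have hx2 : x 2 ≠ 0 := by
      intro h
      rw [e0, e1, h] at hx
      simp at hx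
    have d0 : D0 = 39 * x 2 ^ 2 := by rw [hD0, e0, e1]; ring
    have d1 : D1 = 39 * x 2 ^ 2 := by rw [hD1, e0, e1]; ring
    have d2 : D2 = 39 * x 2 ^ 2 := by rw [hD2, e0, e1]; ring
    have hne : (39 : ℝ) * x 2 ^ 2 ≠ 0 := by positivity
    have w0 : y 0 * x 1 = y 1 * x 0 := by
      rw [d0, d1] at z0
      exact mul_left_cancel₀ hne (by linarith)
    have w1 : y 0 * x 2 = y 2 * x 0 := by
      rw [d0, d2] at z1
      exact mul_left_cancel₀ hne (by linarith)
    exact cklSep_nonneg_of_sq_eq hx2 e0 e1 w0 w1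
  · -- `x` is a multiple of `(1, ±2, 0)`
    have hpos : 0 < a ^ 2 - a * b + b ^ 2 := by
      rw [hba]
      have : 0 < a ^ 2 := by positivity
      nlinarith
    have hx2 : x 2 = 0 := by simpa [hpos.ne'] using zP1
    have e1 : x 1 ^ 2 = (2 * x 0) ^ 2 := by
      rw [mul_pow, hb, ha, hx2, hba]
      ring
    have hx0 : x 0 ≠ 0 := by
      intro h
      rw [hx2, h] at ha
      simp at ha
      exact ha' ha.symm
    have y2 : y 2 = 0 := by
      rw [hx2, mul_zero] at z1
      have := z1.symm
      simpa [p2.ne', hx0] using this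
    have d0 : D0 = 26 * x 0 ^ 2 := by rw [hD0, e1, hx2]; ring
    have d1 : D1 = 104 * x 0 ^ 2 := by rw [hD1, e1, hx2]; ring
    rw [d0, d1] at z0
    have hne : (26 : ℝ) * x 0 ^ 2 ≠ 0 := by positivity
    exact (cklSep_eq_zero_of_sq_eq hx0 hx2 y2 e1 (mul_left_cancel₀ hne (by linarith))).ge

/-- Both forms are invariant under a simultaneous cyclic shift, so the smallest coordinate square
may be moved to index 2. -/
theorem ckl_nonneg_and (x y : Fin 3 → ℝ) :
    0 ≤ ckl x y ∧ (ckl x y = 0 → 0 ≤ cklSep x y) := by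
  have key (x y : Fin 3 → ℝ) : ckl ![x 1, x 2, x 0] ![y 1, y 2, y 0] = ckl x y ∧
      cklSep ![x 1, x 2, x 0] ![y 1, y 2, y 0] = cklSep x y := by
    constructor
    · simp [ckl]; ring
    · simp [cklSep]; ring
  rcases le_total (x 2 ^ 2) (x 0 ^ 2) with h20 | h20
  · rcases le_total (x 2 ^ 2) (x 1 ^ 2) with h21 | h21
    · exact ckl_of_min x y h20 h21
    · have := ckl_of_min ![x 2, x 0, x 1] ![y 2, y 0, y 1] (by simpa using h21)
        (by simpa using h21.trans h20)
      have h1 := key x y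
      have h2 := key ![x 1, x 2, x 0] ![y 1, y 2, y 0]
      simp only [Matrix.cons_val] at h2
      rwa [h2.1, h2.2, h1.1, h1.2] at this
  · rcases le_total (x 0 ^ 2) (x 1 ^ 2) with h01 | h01
    · have := ckl_of_min ![x 1, x 2, x 0] ![y 1, y 2, y 0] (by simpa using h01)
        (by simpa using h20)
      rwa [(key x y).1, (key x y).2] at this
    · have := ckl_of_min ![x 2, x 0, x 1] ![y 2, y 0, y 1] (by simpa using h01.trans h20)
        (by simpa using h01)
      have h1 := key x y
      have h2 := key ![x 1, x 2, x 0] ![y 1, y 2, y 0]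
      simp only [Matrix.cons_val] at h2
      rwa [h2.1, h2.2, h1.1, h1.2] at this

end BiquadraticForm

/-! ### The non-exposed face for two three-dimensional spaces. -/

section ThreeByThree

variable {V W : Type*} [AddCommGroup V] [Module ℝ V] [AddCommGroup W] [Module ℝ W]

theorem repr_equivFun_symm {ι : Type*} [Fintype ι] (b : Basis ι ℝ V) (v : ι → ℝ) (i : ι) :
    b.repr (b.equivFun.symm v) i = v i := by
  rw [← Basis.equivFun_apply, LinearEquiv.apply_symm_apply]

/-- A functional that is nonnegative on the tensor cone and vanishes at `v² ⊗ w²` vanishes on the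
tangent space at that point. -/
theorem tangent_eq_zero {φ : Dual ℝ (Sym[ℝ]^2 V ⊗[ℝ] Sym[ℝ]^2 W)}
    (hφ : ∀ c ∈ (psdCone V).minTensorProduct (psdCone W), 0 ≤ φ c) {v : V} {w : W}
    (h0 : φ (symMul v v ⊗ₜ symMul w w) = 0) (x : V) (y : W) :
    φ (symMul v x ⊗ₜ symMul w w) = 0 ∧ φ (symMul v v ⊗ₜ symMul w y) = 0 := by
  have key (a r : ℝ) (h : ∀ t : ℝ, 0 ≤ t * (2 * a) + t ^ 2 * r) : a = 0 := by
    have hr : 0 ≤ r := by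
      have h1 := h 1
      have h2 := h (-1)
      nlinarith
    -- A near-minimizer of the quadratic; the shift by one covers `r = 0`.
    have h1 := h (-a / (r + 1))
    have hr1 : 0 < r + 1 := by linarith
    have h2 : (-a / (r + 1) * (2 * a) + (-a / (r + 1)) ^ 2 * r) * (r + 1) ^ 2 =
        -(a ^ 2 * (r + 2)) := by
      field_simp
      ring
    have h3 : 0 ≤ -(a ^ 2 * (r + 2)) := by rw [← h2]; positivity
    have h4 : a ^ 2 = 0 := by nlinarith [sq_nonneg a, mul_nonneg (sq_nonneg a) hr]
    simpa using h4
  constructor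
  · refine key _ (φ (symMul x x ⊗ₜ symMul w w)) fun t => ?_
    have h := hφ _ (sq_tmul_sq_mem (v + t • x) w)
    simp only [map_add, map_smul, LinearMap.add_apply, LinearMap.smul_apply,
      TensorProduct.add_tmul, ← TensorProduct.smul_tmul', symMul_comm x v, h0, smul_eq_mul] at h
    linarith
  · refine key _ (φ (symMul v v ⊗ₜ symMul y y)) fun t => ?_
    have h := hφ _ (sq_tmul_sq_mem v (w + t • y))
    simp only [map_add, map_smul, LinearMap.add_apply, LinearMap.smul_apply,
      TensorProduct.tmul_add, TensorProduct.tmul_smul, symMul_comm y w, h0, smul_eq_mul] at h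
    linarith

/-- The first components of nine of the zeros of `ckl`. -/
def zeroLeft : Fin 9 → Fin 3 → ℤ :=
  ![![1, 1, -1], ![-1, 1, 1], ![1, -1, 1], ![1, 2, 0], ![0, 1, 2], ![2, 0, 1],
    ![1, -2, 0], ![0, 1, -2], ![-2, 0, 1]]

/-- The second components of nine of the zeros of `ckl`. -/
def zeroRight : Fin 9 → Fin 3 → ℤ :=
  ![![1, 1, -1], ![-1, 1, 1], ![1, -1, 1], ![2, 1, 0], ![0, 2, 1], ![1, 0, 2],
    ![2, -1, 0], ![0, 2, -1], ![-1, 0, 2]]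

/-- Tangent directions at the nine zeros in the first factor. -/
def dirLeft : Fin 9 → Fin 3 → ℤ :=
  ![![3, 15, 17], ![17, 3, 15], ![15, 17, 3], ![-6, 0, 6], ![6, -6, 0], ![0, 6, -6],
    ![6, 0, 2], ![2, 6, 0], ![0, 2, 6]]

/-- Tangent directions at the nine zeros in the second factor. -/
def dirRight : Fin 9 → Fin 3 → ℤ :=
  ![![15, 3, 17], ![17, 15, 3], ![3, 17, 15], ![0, -6, 6], ![6, 0, -6], ![-6, 6, 0],
    ![0, -6, -2], ![-2, 0, -6], ![-6, -2, 0]]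

/-- The constant is the coefficient 2 of `lastZero`, doubled to clear the `1 / 2` in `symMat`. -/
theorem zero_dir_identity : ∀ i j k l : Fin 3, 4 = ∑ n,
    ((zeroLeft n i * dirLeft n j + dirLeft n i * zeroLeft n j) * (zeroRight n k * zeroRight n l) +
      (zeroLeft n i * zeroLeft n j) *
        (zeroRight n k * dirRight n l + dirRight n k * zeroRight n l)) := by
  decide +kernel

/-- The sum of the nine points `v² ⊗ w²` of the tensor cone with `(v, w)` in the chosen zeros. -/
def zeroSum (b : Basis (Fin 3) ℝ V) (c : Basis (Fin 3) ℝ W) : Sym[ℝ]^2 V ⊗[ℝ] Sym[ℝ]^2 W :=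
  ∑ n, symMul (b.equivFun.symm (Int.cast ∘ zeroLeft n)) (b.equivFun.symm (Int.cast ∘ zeroLeft n)) ⊗ₜ
    symMul (c.equivFun.symm (Int.cast ∘ zeroRight n)) (c.equivFun.symm (Int.cast ∘ zeroRight n))

/-- The point of the tensor cone given by the tenth zero of `ckl`. -/
def lastZero (b : Basis (Fin 3) ℝ V) (c : Basis (Fin 3) ℝ W) : Sym[ℝ]^2 V ⊗[ℝ] Sym[ℝ]^2 W :=
  symMul (b.equivFun.symm 1) (b.equivFun.symm 1) ⊗ₜ symMul (c.equivFun.symm 1) (c.equivFun.symm 1)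

theorem zeroSum_mem (b : Basis (Fin 3) ℝ V) (c : Basis (Fin 3) ℝ W) :
    zeroSum b c ∈ (psdCone V).minTensorProduct (psdCone W) :=
  Submodule.sum_mem _ fun _ _ => sq_tmul_sq_mem _ _

theorem lastZero_mem (b : Basis (Fin 3) ℝ V) (c : Basis (Fin 3) ℝ W) :
    lastZero b c ∈ (psdCone V).minTensorProduct (psdCone W) :=
  sq_tmul_sq_mem _ _

/-- The tenth zero lies in the sum of the tangent spaces at the other nine. -/
theorem two_smul_lastZero (b : Basis (Fin 3) ℝ V) (c : Basis (Fin 3) ℝ W) :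
    (2 : ℝ) • lastZero b c =
      ∑ n, (symMul (b.equivFun.symm (Int.cast ∘ zeroLeft n)) (b.equivFun.symm (Int.cast ∘ dirLeft n)) ⊗ₜ
          symMul (c.equivFun.symm (Int.cast ∘ zeroRight n)) (c.equivFun.symm (Int.cast ∘ zeroRight n)) +
        symMul (b.equivFun.symm (Int.cast ∘ zeroLeft n)) (b.equivFun.symm (Int.cast ∘ zeroLeft n)) ⊗ₜ
          symMul (c.equivFun.symm (Int.cast ∘ zeroRight n)) (c.equivFun.symm (Int.cast ∘ dirRight n))) := by
  apply tensorMat_injective b c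
  ext ⟨i, k⟩ ⟨j, l⟩
  have h := congrArg (Int.cast : ℤ → ℝ) (zero_dir_identity i j k l)
  push_cast at h
  simp only [lastZero, map_smul, Matrix.smul_apply, map_sum, Matrix.sum_apply, map_add,
    Matrix.add_apply, tensorMat_tmul, symMat_symMul, repr_equivFun_symm, Pi.one_apply, smul_eq_mul,
    Function.comp_apply]
  have h' := congrArg (fun r : ℝ => (1 / 2) * r) h
  simp only [Finset.mul_sum] at h'
  norm_num only at h' ⊢
  refine h'.trans (Finset.sum_congr rfl fun n _ => ?_)
  ring

/-- Nonnegative values with sum zero all vanish, so `φ` kills the tangent spaces at the nine points,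
and these span the tenth. -/
theorem dual_lastZero_eq_zero (b : Basis (Fin 3) ℝ V) (c : Basis (Fin 3) ℝ W)
    (φ : Dual ℝ (Sym[ℝ]^2 V ⊗[ℝ] Sym[ℝ]^2 W))
    (hφ : ∀ x ∈ (psdCone V).minTensorProduct (psdCone W), 0 ≤ φ x)
    (h0 : φ (zeroSum b c) = 0) : φ (lastZero b c) = 0 := by
  rw [zeroSum, map_sum, Finset.sum_eq_zero_iff_of_nonneg fun n _ => hφ _ (sq_tmul_sq_mem _ _)] at h0
  have h := congrArg φ (two_smul_lastZero b c)
  rw [map_smul, map_sum, Finset.sum_eq_zero] at h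
  · simpa using h
  · intro n hn
    rw [map_add, (tangent_eq_zero hφ (h0 n hn) _ 0).1, (tangent_eq_zero hφ (h0 n hn) 0 _).2,
      add_zero]

/-- The functional on `Sym² V ⊗ Sym² W` of the biquadratic form `ckl`. -/
def cklDual (b : Basis (Fin 3) ℝ V) (c : Basis (Fin 3) ℝ W) :
    Dual ℝ (Sym[ℝ]^2 V ⊗[ℝ] Sym[ℝ]^2 W) :=
  let M (i k j l : Fin 3) : Dual ℝ (Sym[ℝ]^2 V ⊗[ℝ] Sym[ℝ]^2 W) :=
    Matrix.entryLinearMap ℝ ℝ (i, k) (j, l) ∘ₗ tensorMat b c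
  (9 : ℝ) • (M 0 0 0 0 + M 1 1 1 1 + M 2 2 2 2) +
  (16 : ℝ) • (M 0 1 0 1 + M 1 2 1 2 + M 2 0 2 0) +
  (M 0 2 0 2 + M 1 0 1 0 + M 2 1 2 1) -
  (26 : ℝ) • (M 0 0 1 1 + M 1 1 2 2 + M 2 2 0 0)

theorem cklDual_sq (b : Basis (Fin 3) ℝ V) (c : Basis (Fin 3) ℝ W) (v : V) (w : W) :
    cklDual b c (symMul v v ⊗ₜ symMul w w) = ckl (b.repr v) (c.repr w) := by
  simp only [cklDual, LinearMap.add_apply, LinearMap.sub_apply, LinearMap.smul_apply,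
    LinearMap.comp_apply, Matrix.entryLinearMap_apply, tensorMat_sq, Matrix.vecMulVec_apply,
    prodVec, smul_eq_mul, ckl]
  ring

/-- The functional on `Sym² V ⊗ Sym² W` of the biquadratic form `cklSep`. -/
def cklSepDual (b : Basis (Fin 3) ℝ V) (c : Basis (Fin 3) ℝ W) :
    Dual ℝ (Sym[ℝ]^2 V ⊗[ℝ] Sym[ℝ]^2 W) :=
  let M (i k j l : Fin 3) : Dual ℝ (Sym[ℝ]^2 V ⊗[ℝ] Sym[ℝ]^2 W) :=
    Matrix.entryLinearMap ℝ ℝ (i, k) (j, l) ∘ₗ tensorMat b c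
  (3 : ℝ) • (M 0 1 1 2 + M 1 2 2 0 + M 2 0 0 1) +
  (2 : ℝ) • (M 0 0 1 1 + M 1 1 2 2 + M 2 2 0 0) -
  (M 0 0 0 0 + M 1 1 1 1 + M 2 2 2 2)

theorem cklSepDual_sq (b : Basis (Fin 3) ℝ V) (c : Basis (Fin 3) ℝ W) (v : V) (w : W) :
    cklSepDual b c (symMul v v ⊗ₜ symMul w w) = cklSep (b.repr v) (c.repr w) := by
  simp only [cklSepDual, LinearMap.add_apply, LinearMap.sub_apply, LinearMap.smul_apply,
    LinearMap.comp_apply, Matrix.entryLinearMap_apply, tensorMat_sq, Matrix.vecMulVec_apply,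
    prodVec, smul_eq_mul, cklSep]
  ring

/-- This lexicographic positivity passes to sums: if nonnegative values add up to zero, each is
zero. -/
theorem cklDual_nonneg_and (b : Basis (Fin 3) ℝ V) (c : Basis (Fin 3) ℝ W)
    {x : Sym[ℝ]^2 V ⊗[ℝ] Sym[ℝ]^2 W} (hx : x ∈ (psdCone V).minTensorProduct (psdCone W)) :
    0 ≤ cklDual b c x ∧ (cklDual b c x = 0 → 0 ≤ cklSepDual b c x) := by
  refine minTensorProduct_psdCone_induction
    (p := fun x => 0 ≤ cklDual b c x ∧ (cklDual b c x = 0 → 0 ≤ cklSepDual b c x))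
    (fun v w => ?_) ?_ (fun x y hx hy => ?_) (fun a x ha hx => ?_) hx
  · rw [cklDual_sq, cklSepDual_sq]
    exact ckl_nonneg_and _ _
  · simp
  · rw [map_add, map_add]
    refine ⟨add_nonneg hx.1 hy.1, fun h => add_nonneg (hx.2 ?_) (hy.2 ?_)⟩ <;>
      linarith [hx.1, hy.1]
  · rw [map_smul, map_smul, smul_eq_mul, smul_eq_mul]
    refine ⟨mul_nonneg ha hx.1, fun h => ?_⟩
    rcases mul_eq_zero.1 h with h | h
    · simp [h]
    · exact mul_nonneg ha (hx.2 h)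

/-- The first functional is zero at this point and the second is `-12 t`, against lexicographic
positivity. -/
theorem zeroSum_sub_smul_notMem (b : Basis (Fin 3) ℝ V) (c : Basis (Fin 3) ℝ W) (t : ℝ)
    (ht : 0 < t) :
    zeroSum b c - t • lastZero b c ∉ (psdCone V).minTensorProduct (psdCone W) := by
  intro hmem
  have hrepr (b : Basis (Fin 3) ℝ V) (v : Fin 3 → ℝ) : ⇑(b.repr (b.equivFun.symm v)) = v :=
    funext (repr_equivFun_symm b v)
  have hrepr' (c : Basis (Fin 3) ℝ W) (v : Fin 3 → ℝ) : ⇑(c.repr (c.equivFun.symm v)) = v :=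
    funext (repr_equivFun_symm c v)
  have hzero (n : Fin 9) : ckl (Int.cast ∘ zeroLeft n) (Int.cast ∘ zeroRight n) = 0 := by
    fin_cases n <;> simp [ckl, zeroLeft, zeroRight] <;> norm_num
  have hzero' (n : Fin 9) : cklSep (Int.cast ∘ zeroLeft n) (Int.cast ∘ zeroRight n) = 0 := by
    fin_cases n <;> simp [cklSep, zeroLeft, zeroRight] <;> norm_num
  have h1 : ckl 1 1 = 0 := by simp [ckl]; norm_num
  have h2 : cklSep 1 1 = 12 := by simp [cklSep]; norm_num
  have h := (cklDual_nonneg_and b c hmem).2 (by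
    simp only [zeroSum, lastZero, map_sub, map_sum, map_smul, cklDual_sq, hrepr, hrepr', hzero, h1,
      Finset.sum_const_zero, smul_zero, sub_zero])
  simp only [zeroSum, lastZero, map_sub, map_sum, map_smul, cklSepDual_sq, hrepr, hrepr', hzero',
    h2, Finset.sum_const_zero, smul_eq_mul] at h
  linarith

end ThreeByThree

end ConeFunctors

end

theorem mainTheorem6 {V W : Type*} [AddCommGroup V] [Module ℝ V] [FiniteDimensional ℝ V]
    [AddCommGroup W] [Module ℝ W] [FiniteDimensional ℝ W]
    (m n : ℕ) (hm : finrank ℝ V = m) (hn : finrank ℝ W = n) :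
    (min m n ≤ 2 →
      (IsSpectrahedralCone ((psdCone V).minTensorProduct (psdCone W)) ∧
        IsSpectrahedron
          ((psdCone V).minTensorProduct (psdCone W) : Set (Sym[ℝ]^2 V ⊗[ℝ] Sym[ℝ]^2 W))) ∧
      (IsSDRCone (homCone (psdCone V) (psdCone W)) ∧
        IsSDRSet (homCone (psdCone V) (psdCone W) : Set (Sym[ℝ]^2 V →ₗ[ℝ] Sym[ℝ]^2 W)))) ∧
    (m ≤ 2 →
      IsSDRCone (symPower 2 (psdCone V)) ∧
        IsSDRSet (symPower 2 (psdCone V) : Set (Sym[ℝ]^2 (Sym[ℝ]^2 V)))) ∧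
    (m = 3 → n = 3 →
      (∃ F : PointedCone ℝ (Sym[ℝ]^2 V ⊗[ℝ] Sym[ℝ]^2 W),
        F.IsFaceOf ((psdCone V).minTensorProduct (psdCone W)) ∧
        ¬ IsExposedFace F ((psdCone V).minTensorProduct (psdCone W))) ∧
      ¬ IsSpectrahedron
          ((psdCone V).minTensorProduct (psdCone W) : Set (Sym[ℝ]^2 V ⊗[ℝ] Sym[ℝ]^2 W)) ∧
      ¬ IsSpectrahedralCone ((psdCone V).minTensorProduct (psdCone W))) := by
  subst hm hn
  refine ⟨fun h => ⟨⟨isSpectrahedralCone_minTensorProduct h, isSpectrahedron_minTensorProduct h⟩,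
    isSDRCone_homCone h, isSDRSet_homCone h⟩,
    fun h => ⟨isSDRCone_symPower h, isSDRSet_symPower h⟩, fun hV hW => ?_⟩
  let b : Basis (Fin 3) ℝ V := finBasisOfFinrankEq ℝ V hV
  let c : Basis (Fin 3) ℝ W := finBasisOfFinrankEq ℝ W hW
  have hnot := not_isSpectrahedron_of_sub_notMem (zeroSum_mem b c) (lastZero_mem b c)
    (dual_lastZero_eq_zero b c) (zeroSum_sub_smul_notMem b c)
  refine ⟨⟨_, isFaceOf_minimalFace _ _ (zeroSum_mem b c),
    not_isExposedFace_minimalFace (zeroSum_mem b c) (lastZero_mem b c)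
      (dual_lastZero_eq_zero b c) (zeroSum_sub_smul_notMem b c)⟩, hnot, fun h => hnot ?_⟩
  -- A spectrahedral cone is a spectrahedron with zero constant term.
  obtain ⟨-, k, ψ, -, hψ⟩ := h
  refine isSpectrahedron_of_matrix
    (symMat (Pi.basisFun ℝ (Fin k)).dualBasis ∘ₗ ψ) (fun x => symMat_transpose _ _) fun x => ?_
  rw [hψ, SetLike.mem_coe, PointedCone.mem_comap, mem_psdCone_iff (Pi.basisFun ℝ (Fin k)).dualBasis]
  rfl
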